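/- **Setting.** Let $T\in\mathbb N$, $d\in\mathbb N$, let $\Omega_1$ be a Polish space, $\Omega^t:=\Omega_1^t$ for $0\le t\le T$ ($\Omega^0$ a singleton), $\Omega:=\Omega^T$, and let $\mathcal F_t$ be the universal completion of the Borel $\sigma$-field of $\Omega^t$. For $\omega\in\Omega$ write $\omega^t=(\omega_1,\dots,\omega_t)$; functions on $\Omega^t$ are regarded as functions on $\Omega$ via $\omega\mapsto\omega^t$. For $0\le t<T$ and $\omega^t\in\Omega^t$ let $\mathfrak P_t(\omega^t)$ be a nonempty set of Borel probability measures on $\Omega_1$, such that $\{(\omega^t,P): P\in\mathfrak P_t(\omega^t)\}$ is an analytic subset of $\Omega^t\times\mathfrak M_1(\Omega_1)$, where $\mathfrak M_1(\Omega_1)$ is the space of Borel probability measures with the weak topology. Let $\mathfrak P$ be the set of all measures $P=P_0\otimes\dots\otimes P_{T-1}$ on $\Omega$, $$P(A)=\int_{\Omega_1}\!\!\cdots\int_{\Omega_1}\mathbf 1_A(\omega_1,\dots,\omega_T)\,P_{T-1}(\omega_1,\dots,\omega_{T-1};d\omega_T)\cdots P_0(d\omega_1),$$ where each $P_t:\Omega^t\to\mathfrak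 M_1(\Omega_1)$ is universally measurable with $P_t(\omega^t)\in\mathfrak P_t(\omega^t)$ for all $\omega^t$. A property holds $\mathfrak P$-q.s. if, for every $P\in\mathfrak P$, it holds outside a $P$-null set. Let $\mathcal H^t$ be the set of processes $H=(H_0,\dots,H_{t-1})$ with $H_s:\Omega^s\to\mathbb R^d$ being $\mathcal F_s$-measurable. **Standing assumption.** For $0\le m\le T$, a function $F:\Omega^m\times\mathbb R^{dm}\to\mathbb R\cup\{-\infty\}$ satisfies the standing assumption if 1. there is $\mathcal D\subseteq\mathbb R^{dm}$ with $\inf_{0\le i<m}\ \inf_{x,y\in\mathcal D,\,x_i\ne y_i}|x_i-y_i|>0$ (where $x=(x_0,\dots,x_{m-1})$, $x_i\in\mathbb R^d$, $\inf\emptyset=\infty$) such that $F(\omega,x)=-\infty$ for all $\omega$ and all $x\notin\mathcal D$; 2. there is $C\in\mathbb R$ with $F\le C$ everywhere; 3. $F$ is lower semianalytic on $\Omega^m\times\mathbb R^{dm}$, i.e. $\{F<c\}$ is analytic for every $c\in\mathbb R$; 4. $\inf_{P\in\mathfrak P}E^P[F(\cdot,0)]>-\infty$. **Horizon function and no-arbitrage.**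 The horizon function of $F$ is $$F^\infty(\omega,x)=\lim_{n\to\infty}\ \sup_{\delta>n,\ |x-y|<1/n}\ \tfrac1\delta F(\omega,\delta y).$$ The no-arbitrage condition for $F$ is $\{H\in\mathcal H^m : F^\infty(\cdot,H)\ge0\ \ \mathfrak P\text{-q.s.}\}=\{0\}$, that is, for all $H\in\mathcal H^m$: $F^\infty(\cdot,H)\ge 0$ $\mathfrak P$-q.s. if and only if $H=0$ $\mathfrak P$-q.s. **Recursion.** Given $\Psi:\Omega\times\mathbb R^{dT}\to[-\infty,\infty]$, set $\Psi_T:=\Psi$ and, for $t=T-1,\dots,0$, $$\Phi_t(\omega^t,x^{t+1})=\inf_{P\in\mathfrak P_t(\omega^t)}E^P[\Psi_{t+1}((\omega^t,\cdot),x^{t+1})],\qquad \Psi_t(\omega^t,x^t)=\sup_{\tilde x\in\mathbb R^d}\Phi_t(\omega^t,x^t,\tilde x).$$ Here $E^P[f]=\int f^+\,dP-\int f^-\,dP$ with $\infty-\infty:=-\infty$; the integral of a universally measurable function is taken with respect to the completion of $P$ (and, for an arbitrary nonnegative function, is the supremum of the integrals of the measurable functions below it). Write $\mathrm{NA}(\mathfrak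 P)^t$ for the no-arbitrage condition for $\Psi_t$. **Proposition.** Let $t\in\{0,\dots,T-1\}$ and let $\Psi_{t+1}$ satisfy the standing assumption. If $\mathrm{NA}(\mathfrak P)^{t+1}$ holds, then $\mathrm{NA}(\mathfrak P)^t$ holds. -/

import Mathlib

open MeasureTheory Filter Topology
open scoped ENNReal

namespace RobustDP

/-- `Ω^t`, the `t`-fold product of the one-period space (`Ω^0` is a singleton). -/
abbrev Path (Ω₁ : Type*) (t : ℕ) : Type _ := Fin t → Ω₁

/-- `ℝ^{dt}`, whose elements are written `(x_0, …, x_{t-1})` with `x_i ∈ ℝ^d`. -/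
abbrev Pos (d t : ℕ) : Type := Fin t → EuclideanSpace ℝ (Fin d)

/-- The Euclidean norm on `ℝ^{dt}`. -/
noncomputable def eucNorm {d t : ℕ} (x : Pos d t) : ℝ := ‖WithLp.toLp 2 x‖

/-- The restriction `ω^s = (ω_1, …, ω_s)` of a path `ω ∈ Ω^t`, for `s ≤ t`. -/
def Path.restrict {Ω₁ : Type*} {s t : ℕ} (h : s ≤ t) (ω : Path Ω₁ t) : Path Ω₁ s :=
  fun i => ω (Fin.castLE h i)

/-- `ω^t ⊗_t ω̃ ∈ Ω^{t+1}`. -/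
def Path.extend {Ω₁ : Type*} {t : ℕ} (ω : Path Ω₁ t) (η : Ω₁) : Path Ω₁ (t + 1) :=
  Fin.snoc (α := fun _ => Ω₁) ω η

/-- `(x^t, x̃) ∈ ℝ^{d(t+1)}`. -/
def Pos.extend {d t : ℕ} (x : Pos d t) (y : EuclideanSpace ℝ (Fin d)) : Pos d (t + 1) :=
  Fin.snoc (α := fun _ => EuclideanSpace ℝ (Fin d)) x y

/-- The universal completion of a σ-algebra: the sets which belong to the `P`-completion for
every probability measure `P`. -/
@[reducible] def universalCompletion (X : Type*) [MeasurableSpace X] : MeasurableSpace X where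
  MeasurableSet' A := ∀ P : Measure X, IsProbabilityMeasure P → NullMeasurableSet A P
  measurableSet_empty := fun _ _ => MeasurableSet.empty.nullMeasurableSet
  measurableSet_compl := fun _ hA P hP => (hA P hP).compl
  measurableSet_iUnion := fun _ hf P hP => NullMeasurableSet.iUnion fun i => hf i P hP

/-- Universal measurability of a map: measurability for the universal completion on the domain. -/
def UnivMeasurable {X Y : Type*} [MeasurableSpace X] [MeasurableSpace Y] (f : X → Y) : Prop :=
  Measurable[universalCompletion X] f

/-- Lower semianalytic functions: all strict sublevel sets are analytic. -/
def LowerSemianalytic {X : Type*} [TopologicalSpace X] (f : X → EReal) : Prop :=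
  ∀ c : ℝ, AnalyticSet {x | f x < (c : EReal)}

/-- The expectation `E^P[f] = E^P[f⁺] - E^P[f⁻]` of an extended-real function. In `EReal`, a
finite number minus `∞` is `-∞`, so this is the usual `[-∞, ∞)`-valued expectation of a function
which is bounded above. The Lebesgue integral of a universally measurable function with respect to
`P` is the one with respect to the completion of `P`. -/
noncomputable def expect {X : Type*} [MeasurableSpace X] (P : Measure X) (f : X → EReal) : EReal :=
  ((∫⁻ x, (f x).toENNReal ∂P : ℝ≥0∞) : EReal) - ((∫⁻ x, (-f x).toENNReal ∂P : ℝ≥0∞) : EReal)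

section Market

variable {Ω₁ : Type*} [MeasurableSpace Ω₁]

/-- The iterated integral
`∫ … ∫ f(ω_1, …, ω_t) κ_{t-1}(ω_1, …, ω_{t-1}; dω_t) … κ_0(dω_1)` of `f ≥ 0`. -/
noncomputable def iterInt (κ : (t : ℕ) → Path Ω₁ t → ProbabilityMeasure Ω₁) :
    (t : ℕ) → (Path Ω₁ t → ℝ≥0∞) → ℝ≥0∞
  | 0, f => f default
  | t + 1, f => iterInt κ t (fun ω => ∫⁻ η, f (ω.extend η) ∂(κ t ω : Measure Ω₁))

/-- The set `𝔓` of all measures `P_0 ⊗ … ⊗ P_{T-1}` on `Ω^T`, where each `P_t` is a universally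
measurable kernel with `P_t(ω^t) ∈ 𝔓_t(ω^t)` for all `ω^t`. The σ-algebra on
`ProbabilityMeasure Ω₁` is generated by the evaluations, and this is the Borel σ-algebra of the
weak topology when `Ω₁` is Polish. -/
def priors (𝔓 : (t : ℕ) → Path Ω₁ t → Set (ProbabilityMeasure Ω₁)) (T : ℕ) :
    Set (ProbabilityMeasure (Path Ω₁ T)) :=
  {P | ∃ κ : (t : ℕ) → Path Ω₁ t → ProbabilityMeasure Ω₁,
    (∀ t < T, UnivMeasurable (κ t) ∧ ∀ ω, κ t ω ∈ 𝔓 t ω) ∧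
    ∀ A : Set (Path Ω₁ T), MeasurableSet A →
      (P : Measure (Path Ω₁ T)) A = iterInt κ T (A.indicator 1)}

/-- A property of `ω ∈ Ω` holds `𝔓`-quasi surely: it fails on a `𝔓`-polar set only. -/
def QuasiSurely (𝔓 : (t : ℕ) → Path Ω₁ t → Set (ProbabilityMeasure Ω₁)) (T : ℕ)
    (p : Path Ω₁ T → Prop) : Prop :=
  ∀ P ∈ priors 𝔓 T, ∀ᵐ ω ∂(P : Measure (Path Ω₁ T)), p ω

/-- `𝓗^t`: processes `(H_0, …, H_{t-1})` with values in `ℝ^d` such that `H_s` is an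
`𝓕_s`-measurable function on `Ω^s`. -/
structure Strategy (Ω₁ : Type*) [MeasurableSpace Ω₁] (d t : ℕ) where
  /-- the position `H_s` as a function of `ω^s` -/
  pos : (s : Fin t) → Path Ω₁ s → EuclideanSpace ℝ (Fin d)
  adapted : ∀ s, UnivMeasurable (pos s)

/-- The vector `(H_0, H_1(ω^1), …, H_{t-1}(ω^{t-1})) ∈ ℝ^{dt}` of positions along `ω ∈ Ω^t`. -/
def Strategy.eval {d t : ℕ} (H : Strategy Ω₁ d t) (ω : Path Ω₁ t) : Pos d t :=
  fun s => H.pos s (ω.restrict s.isLt.le)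

end Market

/-- The grid-condition: `inf_i inf {|x_i - y_i| : x, y ∈ D, x_i ≠ y_i} > 0`. -/
def GridCondition {d m : ℕ} (D : Set (Pos d m)) : Prop :=
  ∃ ε : ℝ, 0 < ε ∧ ∀ i, ∀ x ∈ D, ∀ y ∈ D, x i ≠ y i → ε ≤ ‖x i - y i‖

/-- `sup {δ⁻¹ f(δ y) : δ > n, |x - y| < 1/n}`. -/
noncomputable def horizonApprox {d m : ℕ} (f : Pos d m → EReal) (x : Pos d m) (n : ℕ) : EReal :=
  ⨆ (δ : ℝ) (y : Pos d m) (_ : (n : ℝ) < δ ∧ eucNorm (x - y) < 1 / (n : ℝ)),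
    ((1 / δ : ℝ) : EReal) * f (δ • y)

/-- The horizon function `f^∞(x) = lim_n sup {δ⁻¹ f(δ y) : δ > n, |x - y| < 1/n}`. The limit exists
(see `horizon_tendsto`). -/
noncomputable def horizon {d m : ℕ} (f : Pos d m → EReal) (x : Pos d m) : EReal :=
  limsup (horizonApprox f x) atTop

/-- The limit in the definition of the horizon function exists. -/
theorem horizon_tendsto {d m : ℕ} (f : Pos d m → EReal) (x : Pos d m) :
    Tendsto (horizonApprox f x) atTop (𝓝 (horizon f x)) := by
  have hanti : Antitone fun n : ℕ => horizonApprox f x (n + 1) := by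
    intro a b hab
    have hab' : (a : ℝ) ≤ b := by exact_mod_cast hab
    refine iSup_mono fun δ => iSup_mono fun y => iSup_mono' fun h => ⟨⟨?_, ?_⟩, le_rfl⟩
    · have h1 := h.1
      push_cast at h1 ⊢
      linarith
    · refine h.2.trans_le ?_
      push_cast
      exact one_div_le_one_div_of_le (by positivity) (by linarith)
  have h := (tendsto_add_atTop_iff_nat (f := horizonApprox f x) 1).1 (tendsto_atTop_iInf hanti)
  rwa [horizon, h.limsup_eq]

section DynamicProgramming

variable {Ω₁ : Type*} [MeasurableSpace Ω₁] {d : ℕ}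

/-- Extended-real functions on `Ω^t × ℝ^{dt}`. -/
abbrev Integrand (Ω₁ : Type*) (d t : ℕ) : Type _ := Path Ω₁ t → Pos d t → EReal

/-- `Φ_t(ω^t, x^{t+1}) = inf_{P ∈ 𝔓_t(ω^t)} E^P[Ψ_{t+1}(ω^t ⊗_t ·, x^{t+1})]` as a function of
`F = Ψ_{t+1}`. -/
noncomputable def condInf (𝔓 : (t : ℕ) → Path Ω₁ t → Set (ProbabilityMeasure Ω₁)) (t : ℕ)
    (F : Integrand Ω₁ d (t + 1)) (ω : Path Ω₁ t) (x : Pos d (t + 1)) : EReal :=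
  ⨅ P ∈ 𝔓 t ω, expect (P : Measure Ω₁) (fun η => F (ω.extend η) x)

/-- One step of the recursion: `Ψ_t(ω^t, x^t) = sup_{x̃ ∈ ℝ^d} Φ_t(ω^t, x^t, x̃)` as a function of
`F = Ψ_{t+1}`. -/
noncomputable def dpStep (𝔓 : (t : ℕ) → Path Ω₁ t → Set (ProbabilityMeasure Ω₁)) (t : ℕ)
    (F : Integrand Ω₁ d (t + 1)) : Integrand Ω₁ d t :=
  fun ω x => ⨆ y : EuclideanSpace ℝ (Fin d), condInf 𝔓 t F ω (x.extend y)

/-- The function `Ψ_t`, `t ≤ T`, of the backward recursion started at `Ψ_T = Ψ`. -/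
noncomputable def dynProg (𝔓 : (t : ℕ) → Path Ω₁ t → Set (ProbabilityMeasure Ω₁)) {T : ℕ}
    (Ψ : Integrand Ω₁ d T) {t : ℕ} (h : t ≤ T) : Integrand Ω₁ d t :=
  Nat.decreasingInduction (motive := fun s _ => Integrand Ω₁ d s)
    (fun s _ F => dpStep 𝔓 s F) Ψ h

theorem dynProg_self (𝔓 : (t : ℕ) → Path Ω₁ t → Set (ProbabilityMeasure Ω₁)) {T : ℕ}
    (Ψ : Integrand Ω₁ d T) : dynProg 𝔓 Ψ le_rfl = Ψ :=
  Nat.decreasingInduction_self _ _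

theorem dynProg_succ (𝔓 : (t : ℕ) → Path Ω₁ t → Set (ProbabilityMeasure Ω₁)) {T : ℕ}
    (Ψ : Integrand Ω₁ d T) {t : ℕ} (h : t < T) :
    dynProg 𝔓 Ψ h.le = dpStep 𝔓 t (dynProg 𝔓 Ψ (Nat.succ_le_of_lt h)) :=
  Nat.decreasingInduction_succ_left _ _ _ _

/-- The standing assumption on a function `F` on `Ω^m × ℝ^{dm}`, `m ≤ T`, in the market with horizon
`T`: `F = -∞` off a set with the grid-condition, `F` is bounded above by a real constant,
`F` is lower semianalytic, and `inf_{P ∈ 𝔓} E^P[F(0)] > -∞`. -/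
structure StandingAssumption [TopologicalSpace Ω₁]
    (𝔓 : (t : ℕ) → Path Ω₁ t → Set (ProbabilityMeasure Ω₁)) (T : ℕ) {m : ℕ} (hm : m ≤ T)
    (F : Integrand Ω₁ d m) : Prop where
  grid : ∃ D : Set (Pos d m), GridCondition D ∧ ∀ ω, ∀ x ∉ D, F ω x = ⊥
  bounded : ∃ C : ℝ, ∀ ω x, F ω x ≤ (C : EReal)
  lsa : LowerSemianalytic (fun p : Path Ω₁ m × Pos d m => F p.1 p.2)
  zero : ⊥ < ⨅ P ∈ priors 𝔓 T,
    expect (P : Measure (Path Ω₁ T)) (fun ω => F (ω.restrict hm) 0)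

/-- The no-arbitrage condition `{H ∈ 𝓗^m : F^∞(H) ≥ 0 𝔓-q.s.} = {0}`, for a function `F` on
`Ω^m × ℝ^{dm}`, `m ≤ T`; processes are identified when they agree `𝔓`-q.s. -/
def NoArbitrage (𝔓 : (t : ℕ) → Path Ω₁ t → Set (ProbabilityMeasure Ω₁)) (T : ℕ) {m : ℕ}
    (hm : m ≤ T) (F : Integrand Ω₁ d m) : Prop :=
  ∀ H : Strategy Ω₁ d m,
    QuasiSurely 𝔓 T (fun ω => 0 ≤ horizon (F (ω.restrict hm)) (H.eval (ω.restrict hm))) ↔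
      QuasiSurely 𝔓 T (fun ω => H.eval (ω.restrict hm) = 0)

end DynamicProgramming

end RobustDP

open scoped ProbabilityTheory

/-! Nonnegativity of the horizon function can be carried from `Ψ_t` to `Ψ_{t+1}` through both
operations of the recursion, which turns a position that is free of downside at time `t` into one at
time `t + 1`.

The supremum: if `Ψ_t^∞(x) ≥ 0`, choose scales and almost maximizers in the last variable. After
rescaling they either accumulate at some `h`, and then `Φ_t^∞(x, h) ≥ 0`, or they explode, and
normalizing them once more gives a unit vector `h` with `Φ_t^∞(0, h) ≥ 0`
(`exists_zero_le_horizon_of_iSup`). The infimum: if `Φ_t^∞(x) ≥ 0` at `ω`, then for every model in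
`𝔓 t ω` Markov's inequality applied to `C - Ψ_{t+1}` shows that `Ψ_{t+1}^∞(x) ≥ 0` almost surely
(`ae_zero_le_horizon`).

Let now `Ψ_t^∞(H) ≥ 0` quasi surely. The exploding case is polar, since otherwise a selected unit
direction would be a nonzero strategy, trading only at time `t`, that violates no-arbitrage at `t +
1`. In the other case a selected `h` extends `H`, and no-arbitrage at `t + 1` forces `(H, h) = 0`.
Conversely, for `H = 0` it suffices that `Φ_t(0) > -∞` quasi surely. If this failed, measurably
selected bad models would contradict the lower bound on the expectations
(`IsAdmissible.ae_bot_lt_condInf`).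

The selections rest on two facts. The grid condition makes the effective domain countable, so the
sets in question are countable combinations of universally measurable rectangles. And `Φ_t` is lower
semianalytic, because integration of such functions against a measurable family of laws preserves
analyticity of sublevel sets (`analyticSet_lt_lintegral`, via compact approximation of analytic
sets). -/

namespace RobustDP

/-! ### Universal measurability -/

section UnivMeasurable

variable {X Y Z : Type*} [MeasurableSpace X] [MeasurableSpace Y] [MeasurableSpace Z]

theorem measurableSet_universalCompletion {A : Set X} (hA : MeasurableSet A) :
    MeasurableSet[universalCompletion X] A :=
  fun _ _ => hA.nullMeasurableSet

theorem UnivMeasurable.of_measurable {f : X → Y} (hf : Measurable f) : UnivMeasurable f :=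
  fun _ hs => measurableSet_universalCompletion (hf hs)

theorem UnivMeasurable.aemeasurable [MeasurableSpace.CountablyGenerated Y] {f : X → Y}
    (hf : UnivMeasurable f) (μ : Measure X) [hμ : IsProbabilityMeasure μ] : AEMeasurable f μ :=
  NullMeasurable.aemeasurable fun _ hs => hf hs μ hμ

/-- Each `P` is pushed forward along a measurable modification of `f`, and `B` is measurable for the
completion of the image. This is what makes universal measurability stable under composition. -/
theorem UnivMeasurable.preimage [MeasurableSpace.CountablyGenerated Y] {f : X → Y}
    (hf : UnivMeasurable f) {B : Set Y} (hB : MeasurableSet[universalCompletion Y] B) :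
    MeasurableSet[universalCompletion X] (f ⁻¹' B) := by
  intro P hP
  have hae := hf.aemeasurable P
  have := Measure.isProbabilityMeasure_map hae
  have hq : Measure.QuasiMeasurePreserving (hae.mk f) P (P.map f) :=
    ⟨hae.measurable_mk, by rw [Measure.map_congr hae.ae_eq_mk]⟩
  refine ((hB (P.map f) this).preimage hq).congr ?_
  filter_upwards [hae.ae_eq_mk] with x hx
  exact congrArg (· ∈ B) hx.symm

theorem UnivMeasurable.comp [MeasurableSpace.CountablyGenerated Y] {g : Y → Z} {f : X → Y}
    (hg : UnivMeasurable g) (hf : UnivMeasurable f) : UnivMeasurable (g ∘ f) :=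
  fun _ hs => hf.preimage (hg hs)

theorem UnivMeasurable.pi {ι : Type*} {W : ι → Type*} [∀ i, MeasurableSpace (W i)]
    {f : X → ∀ i, W i} (hf : ∀ i, UnivMeasurable fun x => f x i) : UnivMeasurable f :=
  @measurable_pi_lambda _ _ _ (universalCompletion X) _ f hf

theorem UnivMeasurable.piecewise {f g : X → Y} (hf : UnivMeasurable f) (hg : UnivMeasurable g)
    {A : Set X} (hA : MeasurableSet[universalCompletion X] A) [DecidablePred (· ∈ A)] :
    UnivMeasurable (A.piecewise f g) :=
  Measurable.piecewise (m := universalCompletion X) hA hf hg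

end UnivMeasurable

/-- Evaluations on a countable generating algebra determine the σ-algebra, by a π-system argument.
Countable generation is what makes universally measurable kernels almost everywhere measurable. -/
instance probabilityMeasure_countablyGenerated {Y : Type*} [MeasurableSpace Y]
    [MeasurableSpace.CountablyGenerated Y] :
    MeasurableSpace.CountablyGenerated (ProbabilityMeasure Y) := by
  let S : Set (Set Y) := generateSetAlgebra (MeasurableSpace.countableGeneratingSet Y)
  have hS : S.Countable :=
    countable_generateSetAlgebra MeasurableSpace.countable_countableGeneratingSet
  have := hS.to_subtype
  let e : ProbabilityMeasure Y → S → ℝ≥0∞ := fun P s => (P : Measure Y) s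
  have hgen : ‹MeasurableSpace Y› = MeasurableSpace.generateFrom S := by
    rw [generateFrom_generateSetAlgebra_eq, MeasurableSpace.generateFrom_countableGeneratingSet]
  have hmeas : ∀ s ∈ S, MeasurableSet s := fun s hs => by
    rw [hgen]; exact MeasurableSpace.measurableSet_generateFrom hs
  have key : ProbabilityMeasure.instMeasurableSpace =
      MeasurableSpace.comap e inferInstance := by
    apply le_antisymm
    · let _ : MeasurableSpace (ProbabilityMeasure Y) := MeasurableSpace.comap e inferInstance
      have : Measurable[MeasurableSpace.comap e inferInstance]
          (fun P : ProbabilityMeasure Y => (P : Measure Y)) := by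
        refine Measurable.measure_of_isPiSystem_of_isProbabilityMeasure hgen
          (fun _ hs _ ht _ => isSetAlgebra_generateSetAlgebra.inter_mem hs ht) fun s hs => ?_
        exact (measurable_pi_apply (⟨s, hs⟩ : S)).comp (comap_measurable e)
      exact this.comap_le
    · refine Measurable.comap_le (measurable_pi_iff.2 fun s => ?_)
      exact (Measure.measurable_coe (hmeas s s.2)).comp measurable_subtype_coe
  rw [key]
  exact MeasurableSpace.CountablyGenerated.comap e

/-! ### Analytic sets: capacitability and integrals -/

section Analytic

/-- The points of the Baire space which are bounded by `σ` in the first `n` coordinates. -/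
def baireBox (σ : ℕ → ℕ) (n : ℕ) : Set (ℕ → ℕ) := {τ | ∀ i < n, τ i ≤ σ i}

/-- The bounds are fixed one coordinate at a time. Relaxing a single bound gives an increasing
union, along which the measure is continuous even though the images need not be measurable. -/
theorem exists_lt_measure_image_baireBox {Y : Type*} [MeasurableSpace Y] (μ : Measure Y)
    (f : (ℕ → ℕ) → Y) {a : ℝ≥0∞} (ha : a < μ (Set.range f)) :
    ∃ σ, ∀ n, a < μ (f '' baireBox σ n) := by
  have step : ∀ (n : ℕ) (σ : ℕ → ℕ), a < μ (f '' baireBox σ n) →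
      ∃ k, a < μ (f '' baireBox (Function.update σ n k) (n + 1)) := by
    intro n σ h
    have hU : f '' baireBox σ n = ⋃ k, f '' baireBox (Function.update σ n k) (n + 1) := by
      rw [← Set.image_iUnion]
      congr 1
      ext τ
      simp only [baireBox, Set.mem_ofPred_eq, Set.mem_iUnion]
      constructor
      · intro hτ
        refine ⟨τ n, fun i hi => ?_⟩
        rcases Nat.lt_succ_iff_lt_or_eq.1 hi with h | rfl
        · rw [Function.update_of_ne h.ne]; exact hτ i h
        · simp
      · rintro ⟨k, hk⟩ i hi
        have := hk i (by omega)
        rwa [Function.update_of_ne hi.ne] at this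
    have hmono : Monotone fun k => f '' baireBox (Function.update σ n k) (n + 1) := by
      intro k l hkl
      refine Set.image_mono fun τ hτ i hi => (hτ i hi).trans ?_
      rcases eq_or_ne i n with rfl | hin
      · simpa using hkl
      · simp [Function.update_of_ne hin]
    rw [hU, hmono.measure_iUnion] at h
    exact lt_iSup_iff.1 h
  choose! k hk using step
  let s : ℕ → ℕ → ℕ := fun n => Nat.rec (fun _ => 0) (fun n σ => Function.update σ n (k n σ)) n
  have hs : ∀ n, s (n + 1) = Function.update (s n) n (k n (s n)) := fun n => rfl
  have hpos : ∀ n, a < μ (f '' baireBox (s n) n) := by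
    intro n
    induction n with
    | zero =>
      have : baireBox (s 0) 0 = Set.univ := by ext; simp [baireBox]
      rwa [this, Set.image_univ]
    | succ n ih => rw [hs]; exact hk n _ ih
  have hstab : ∀ i n, i < n → s n i = s (i + 1) i := by
    intro i n hn
    induction n, hn using Nat.le_induction with
    | base => rfl
    | succ n hn ih => rw [hs, Function.update_of_ne (by omega), ih]
  refine ⟨fun i => s (i + 1) i, fun n => ?_⟩
  convert hpos n using 3
  ext τ
  simp only [baireBox, Set.mem_ofPred_eq]
  exact forall₂_congr fun i hi => by rw [hstab i n hi]

theorem isCompact_Iic_baire (σ : ℕ → ℕ) : IsCompact (Set.Iic σ) := by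
  have : Set.Iic σ = Set.univ.pi fun i => Set.Iic (σ i) := by ext; simp [Pi.le_def]
  rw [this]
  exact isCompact_univ_pi fun i => (Set.finite_Iic _).isCompact

/-- Compactness of `Iic σ` removes the closures: points from ever smaller boxes have a subsequence
converging into `Iic σ`. -/
theorem iInter_closure_image_baireBox {Y : Type*} [TopologicalSpace Y]
    [TopologicalSpace.MetrizableSpace Y] {f : (ℕ → ℕ) → Y} (hf : Continuous f) (σ : ℕ → ℕ) :
    ⋂ n, closure (f '' baireBox σ n) = f '' Set.Iic σ := by
  apply Set.Subset.antisymm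
  · let _ : MetricSpace Y := TopologicalSpace.metrizableSpaceMetric Y
    intro y hy
    have h1 : ∀ n : ℕ, ∃ τ ∈ baireBox σ n, dist y (f τ) < 1 / ((n : ℝ) + 1) := by
      intro n
      obtain ⟨_, ⟨τ, hτ, rfl⟩, h⟩ := Metric.mem_closure_iff.1 (Set.mem_iInter.1 hy n)
        (1 / ((n : ℝ) + 1)) (by positivity)
      exact ⟨τ, hτ, h⟩
    choose τ hτ hd using h1
    -- Truncating `τ n` by `σ` moves it into the compact set without changing its first `n`
    -- coordinates.
    obtain ⟨ρ, hρ, φ, hφ, hlim⟩ := (isCompact_Iic_baire σ).tendsto_subseq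
      (x := fun n => τ n ⊓ σ) (fun n => (inf_le_right : τ n ⊓ σ ≤ σ))
    refine ⟨ρ, hρ, ?_⟩
    have hlim' : Tendsto (fun n => τ (φ n)) atTop (𝓝 ρ) := by
      rw [tendsto_pi_nhds] at hlim ⊢
      intro i
      refine (hlim i).congr' ?_
      filter_upwards [eventually_gt_atTop i] with n hn
      have := hτ (φ n) i (hn.trans_le (hφ.id_le n))
      simp [this]
    have h2 : Tendsto (fun n => f (τ (φ n))) atTop (𝓝 y) := by
      rw [tendsto_iff_dist_tendsto_zero]
      refine squeeze_zero (fun _ => dist_nonneg) (fun n => ?_)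
        (tendsto_one_div_add_atTop_nhds_zero_nat.comp hφ.tendsto_atTop)
      rw [dist_comm]
      exact (hd (φ n)).le
    exact tendsto_nhds_unique ((hf.tendsto ρ).comp hlim') h2
  · refine Set.subset_iInter fun n => (Set.image_mono ?_).trans subset_closure
    exact fun τ hτ i _ => hτ i

theorem baireBox_antitone (σ : ℕ → ℕ) : Antitone (baireBox σ) :=
  fun _ _ h _ hτ i hi => hτ i (hi.trans_le h)

theorem le_measure_image_Iic {Y : Type*} [TopologicalSpace Y]
    [TopologicalSpace.MetrizableSpace Y] [MeasurableSpace Y] [OpensMeasurableSpace Y]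
    (μ : Measure Y) [IsFiniteMeasure μ] {f : (ℕ → ℕ) → Y} (hf : Continuous f) {σ : ℕ → ℕ}
    {a : ℝ≥0∞} (h : ∀ n, a ≤ μ (closure (f '' baireBox σ n))) : a ≤ μ (f '' Set.Iic σ) := by
  rw [← iInter_closure_image_baireBox hf, Antitone.measure_iInter]
  · exact le_iInf h
  · exact fun m n hmn => closure_mono (Set.image_mono (baireBox_antitone σ hmn))
  · exact fun n => isClosed_closure.measurableSet.nullMeasurableSet
  · exact ⟨0, measure_ne_top _ _⟩

/-- Analytic sets are measurable for the completion of every finite measure. -/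
theorem _root_.MeasureTheory.AnalyticSet.nullMeasurableSet {Y : Type*} [TopologicalSpace Y]
    [TopologicalSpace.MetrizableSpace Y] [MeasurableSpace Y] [OpensMeasurableSpace Y]
    {A : Set Y} (hA : AnalyticSet A) (μ : Measure Y) [IsFiniteMeasure μ] :
    NullMeasurableSet A μ := by
  rw [AnalyticSet] at hA
  rcases hA with rfl | ⟨f, hf, rfl⟩
  · exact MeasurableSet.empty.nullMeasurableSet
  rcases eq_or_ne (μ (Set.range f)) 0 with h0 | h0
  · exact NullMeasurableSet.of_null h0
  obtain ⟨u, -, hu, hlim⟩ := exists_seq_strictMono_tendsto' (pos_iff_ne_zero.2 h0)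
  choose σ hσ using fun n => exists_lt_measure_image_baireBox μ f (hu n).2
  have hK : ∀ n, u n ≤ μ (f '' Set.Iic (σ n)) := fun n =>
    le_measure_image_Iic μ hf fun k => (hσ n k).le.trans (measure_mono subset_closure)
  have hm : MeasurableSet (⋃ n, f '' Set.Iic (σ n)) :=
    MeasurableSet.iUnion fun n => ((isCompact_Iic_baire _).image hf).measurableSet
  have hsub : ⋃ n, f '' Set.Iic (σ n) ⊆ Set.range f :=
    Set.iUnion_subset fun n => Set.image_subset_range _ _
  have hle : μ (Set.range f) ≤ μ (⋃ n, f '' Set.Iic (σ n)) :=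
    le_of_tendsto' hlim fun n => (hK n).trans (measure_mono (Set.subset_iUnion (fun n => f '' Set.Iic (σ n)) n))
  refine hm.nullMeasurableSet.congr ?_
  exact ae_eq_of_subset_of_measure_ge hsub hle hm.nullMeasurableSet (measure_ne_top _ _)

theorem _root_.MeasureTheory.AnalyticSet.measurableSet_universalCompletion {Y : Type*} [TopologicalSpace Y]
    [TopologicalSpace.MetrizableSpace Y] [MeasurableSpace Y] [OpensMeasurableSpace Y]
    {A : Set Y} (hA : AnalyticSet A) : MeasurableSet[universalCompletion Y] A :=
  fun P _ => hA.nullMeasurableSet P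

/-- The box depends on `σ` only through its first `n` coordinates, hence on a countable parameter.
-/
theorem measurable_measure_closure_image_baireBox {Z Y : Type*} [MeasurableSpace Z]
    [TopologicalSpace Y] [MeasurableSpace Y] [OpensMeasurableSpace Y] {κ : Z → Measure Y} (hκ : Measurable κ)
    (f : (ℕ → ℕ) → Y) (n : ℕ) :
    Measurable fun p : Z × (ℕ → ℕ) => κ p.1 (closure (f '' baireBox p.2 n)) := by
  let g : Z × (Fin n → ℕ) → ℝ≥0∞ := fun p =>
    κ p.1 (closure (f '' {τ | ∀ i : Fin n, τ i ≤ p.2 i}))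
  have hg : Measurable g := by
    apply measurable_from_prod_countable_left
    intro s
    exact Measure.measurable_measure.1 hκ (closure (f '' {τ | ∀ i : Fin n, τ i ≤ s i}))
      isClosed_closure.measurableSet
  have hr : Measurable fun p : Z × (ℕ → ℕ) => (p.1, fun i : Fin n => p.2 i) := by fun_prop
  convert hg.comp hr using 1
  ext p
  simp only [g, Function.comp_apply, baireBox, Fin.forall_iff]

variable {Z Y : Type*} [TopologicalSpace Z] [PolishSpace Z] [MeasurableSpace Z] [BorelSpace Z]
  [TopologicalSpace Y] [TopologicalSpace.MetrizableSpace Y]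
  [MeasurableSpace Y] [OpensMeasurableSpace Y]

/-- The measure of an analytic set is a lower semianalytic function of the parameter (up to a sign)
of a measurable family of finite measures. -/
theorem _root_.MeasureTheory.AnalyticSet.analyticSet_lt_measure {κ : Z → Measure Y} (hκ : Measurable κ)
    [∀ z, IsFiniteMeasure (κ z)] {A : Set Y} (hA : AnalyticSet A) (a : ℝ≥0∞) :
    AnalyticSet {z | a < κ z A} := by
  rw [AnalyticSet] at hA
  rcases hA with rfl | ⟨f, hf, rfl⟩
  · simpa using analyticSet_empty
  -- The intermediate value keeps the inequality strict when the measures decrease to their limit.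
  have hB : MeasurableSet {p : Z × (ℕ → ℕ) × ℝ≥0∞ | a < p.2.2 ∧
      ∀ n, p.2.2 ≤ κ p.1 (closure (f '' baireBox p.2.1 n))} := by
    rw [Set.ofPred_and, Set.ofPred_forall]
    refine (measurableSet_lt (by fun_prop) (by fun_prop)).inter (MeasurableSet.iInter fun n =>
      measurableSet_le (by fun_prop) ?_)
    exact (measurable_measure_closure_image_baireBox hκ f n).comp
      (by fun_prop : Measurable fun p : Z × (ℕ → ℕ) × ℝ≥0∞ => (p.1, p.2.1))
  convert hB.analyticSet.image_of_continuous continuous_fst using 1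
  ext z
  simp only [Set.mem_ofPred_eq, Set.mem_image, Prod.exists, exists_and_right, exists_eq_right]
  constructor
  · intro h
    obtain ⟨b, hab, hb⟩ := exists_between h
    obtain ⟨σ, hσ⟩ := exists_lt_measure_image_baireBox (κ z) f hb
    exact ⟨σ, b, hab, fun n => (hσ n).le.trans (measure_mono subset_closure)⟩
  · rintro ⟨σ, b, hab, hb⟩
    exact hab.trans_le ((le_measure_image_Iic (κ z) hf hb).trans
      (measure_mono (Set.image_subset_range _ _)))

theorem _root_.MeasureTheory.AnalyticSet.inter {X : Type*} [TopologicalSpace X] [T2Space X]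
    {A B : Set X} (hA : AnalyticSet A) (hB : AnalyticSet B) : AnalyticSet (A ∩ B) := by
  rw [Set.inter_eq_iInter]
  exact AnalyticSet.iInter fun b => by cases b <;> assumption

theorem volume_Ico_ofReal_lt (c : ℝ≥0∞) :
    volume {s : ℝ | 0 ≤ s ∧ ENNReal.ofReal s < c} = c := by
  rcases eq_or_ne c ⊤ with rfl | hc
  · have : {s : ℝ | 0 ≤ s ∧ ENNReal.ofReal s < ⊤} = Set.Ici 0 := by ext; simp
    rw [this, Real.volume_Ici]
  · have : {s : ℝ | 0 ≤ s ∧ ENNReal.ofReal s < c} = Set.Ico 0 c.toReal := by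
      ext s
      simp only [Set.mem_ofPred_eq, Set.mem_Ico]
      exact and_congr_right fun hs => ENNReal.ofReal_lt_iff_lt_toReal hs hc
    rw [this, Real.volume_Ico, sub_zero, ENNReal.ofReal_toReal hc]

theorem univMeasurable_of_analyticSet {X : Type*} [TopologicalSpace X]
    [TopologicalSpace.MetrizableSpace X] [MeasurableSpace X] [OpensMeasurableSpace X]
    {g : X → ℝ≥0∞} (hg : ∀ c, AnalyticSet {x | c < g x}) : UnivMeasurable g :=
  measurable_of_Ioi (mδ := universalCompletion X) fun c => (hg c).measurableSet_universalCompletion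

/-- The integral of a nonnegative function with analytic strict superlevel sets, with respect to a
measurable family of probability measures, has analytic strict superlevel sets. -/
theorem analyticSet_lt_lintegral [PolishSpace Y] [BorelSpace Y] {κ : Z → Measure Y}
    (hκ : Measurable κ) [∀ z, IsProbabilityMeasure (κ z)] {g : Y → ℝ≥0∞}
    (hg : ∀ c, AnalyticSet {y | c < g y}) (a : ℝ≥0∞) :
    AnalyticSet {z | a < ∫⁻ y, g y ∂κ z} := by
  -- The integral is the product measure of the region under the graph, so the result for sets
  -- applies.
  let S : Set (Y × ℝ) := {p | 0 ≤ p.2 ∧ ENNReal.ofReal p.2 < g p.1}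
  let I : ℕ → Set ℝ := fun n => Set.Iic n
  have hS : AnalyticSet S := by
    have : S = ⋃ q : ℚ, Prod.fst ⁻¹' {y | ENNReal.ofReal q < g y} ∩
        Prod.snd ⁻¹' {s : ℝ | 0 ≤ s ∧ s ≤ q} := by
      ext ⟨y, s⟩
      simp only [S, Set.mem_ofPred_eq, Set.mem_iUnion, Set.mem_inter_iff, Set.mem_preimage]
      constructor
      · rintro ⟨h0, hs⟩
        obtain ⟨q, -, hq1, hq2⟩ := ENNReal.lt_iff_exists_rat_btwn.1 hs
        refine ⟨q, hq2, h0, ?_⟩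
        by_contra! hlt
        exact absurd hq1 (not_lt.2 (ENNReal.ofReal_le_ofReal hlt.le))
      · rintro ⟨q, hq, h0, hs⟩
        exact ⟨h0, (ENNReal.ofReal_le_ofReal hs).trans_lt hq⟩
    rw [this]
    refine AnalyticSet.iUnion fun q => AnalyticSet.inter ((hg _).preimage continuous_fst) ?_
    have : MeasurableSet {s : ℝ | 0 ≤ s ∧ s ≤ q} := measurableSet_Icc
    exact this.analyticSet.preimage continuous_snd
  have hSn : ∀ n : ℕ, AnalyticSet (S ∩ Prod.snd ⁻¹' I n) := fun n =>
    hS.inter ((measurableSet_Iic (a := (n : ℝ))).analyticSet.preimage continuous_snd)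
  -- The cut-off makes the product measures finite, and the integral is recovered as a supremum over
  -- `n`.
  let ν : ℕ → Measure ℝ := fun n => volume.restrict (Set.Icc 0 n)
  have hfib : ∀ n y, ν n (Prod.mk y ⁻¹' (S ∩ Prod.snd ⁻¹' I n)) =
      volume ({s : ℝ | 0 ≤ s ∧ ENNReal.ofReal s < g y} ∩ I n) := by
    intro n y
    rw [Measure.restrict_apply' measurableSet_Icc]
    congr 1
    ext s
    simp only [S, I, Set.mem_inter_iff, Set.mem_preimage, Set.mem_ofPred_eq, Set.mem_Icc,
      Set.mem_Iic]
    tauto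
  have hprod : ∀ n z, ((κ z).prod (ν n)) (S ∩ Prod.snd ⁻¹' I n) =
      ∫⁻ y, volume ({s : ℝ | 0 ≤ s ∧ ENNReal.ofReal s < g y} ∩ I n) ∂κ z := by
    intro n z
    have hnull := (hSn n).nullMeasurableSet ((κ z).prod (ν n))
    rw [← lintegral_indicator_one₀ hnull, lintegral_prod]
    · refine lintegral_congr fun y => ?_
      rw [← hfib, ← lintegral_indicator_one₀]
      · rfl
      · have hm : MeasurableSet {s : ℝ | 0 ≤ s ∧ ENNReal.ofReal s < g y} :=
          measurableSet_Ici.inter (measurableSet_lt ENNReal.measurable_ofReal measurable_const)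
        exact (hm.inter measurableSet_Iic).nullMeasurableSet
    · exact aemeasurable_const.indicator₀ hnull
  have hsup : ∀ z, ∫⁻ y, g y ∂κ z = ⨆ n, ((κ z).prod (ν n)) (S ∩ Prod.snd ⁻¹' I n) := by
    intro z
    have hmono : ∀ y, Monotone fun n => {s : ℝ | 0 ≤ s ∧ ENNReal.ofReal s < g y} ∩ I n :=
      fun y m n hmn => Set.inter_subset_inter_right _
        (Set.Iic_subset_Iic.2 (by exact_mod_cast hmn))
    simp_rw [hprod]
    rw [← lintegral_iSup']
    · refine lintegral_congr fun y => ?_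
      rw [← (hmono y).measure_iUnion, ← Set.inter_iUnion]
      have : ⋃ n, I n = Set.univ := by
        refine Set.eq_univ_of_forall fun s => ?_
        obtain ⟨n, hn⟩ := exists_nat_ge s
        exact Set.mem_iUnion.2 ⟨n, hn⟩
      rw [this, Set.inter_univ, volume_Ico_ofReal_lt]
    · intro n
      have hmeas : Measurable fun c : ℝ≥0∞ =>
          volume ({s : ℝ | 0 ≤ s ∧ ENNReal.ofReal s < c} ∩ I n) := by
        refine Monotone.measurable fun c d hcd => measure_mono ?_
        exact Set.inter_subset_inter_left _ fun s hs => ⟨hs.1, hs.2.trans_le hcd⟩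
      exact hmeas.comp_aemeasurable ((univMeasurable_of_analyticSet hg).aemeasurable (κ z))
    · exact Eventually.of_forall fun y m n hmn => measure_mono (hmono y hmn)
  have : {z | a < ∫⁻ y, g y ∂κ z} = ⋃ n, {z | a < ((κ z).prod (ν n)) (S ∩ Prod.snd ⁻¹' I n)} := by
    ext z
    simp only [Set.mem_ofPred_eq, hsup, lt_iSup_iff, Set.mem_iUnion]
  rw [this]
  refine AnalyticSet.iUnion fun n => AnalyticSet.analyticSet_lt_measure ?_ (hSn n) a
  let K : ProbabilityTheory.Kernel Z Y := ⟨κ, hκ⟩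
  have : ProbabilityTheory.IsMarkovKernel K := ⟨fun z => inferInstanceAs (IsProbabilityMeasure (κ z))⟩
  have hK := (K ×ₖ ProbabilityTheory.Kernel.const Z (ν n)).measurable
  convert hK using 1
  ext1 z
  rw [ProbabilityTheory.Kernel.prod_apply, ProbabilityTheory.Kernel.const_apply]
  rfl

end Analytic

/-! ### Measurable selection -/

section Selection

/-- The reversed list of the first `n` coordinates of the lexicographically least point of the fibre
`f ⁻¹' {x}`. -/
noncomputable def leastPrefix {X : Type*} (f : (ℕ → ℕ) → X) : ℕ → X → List ℕ
  | 0, _ => []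
  | n + 1, x => sInf {k | ∃ τ, f τ = x ∧ PiNat.res τ (n + 1) = k :: leastPrefix f n x} ::
      leastPrefix f n x

theorem exists_res_eq_leastPrefix {X : Type*} (f : (ℕ → ℕ) → X) {x : X} (hx : x ∈ Set.range f)
    (n : ℕ) : ∃ τ, f τ = x ∧ PiNat.res τ n = leastPrefix f n x := by
  induction n with
  | zero =>
    obtain ⟨τ, hτ⟩ := hx
    exact ⟨τ, hτ, rfl⟩
  | succ n ih =>
    obtain ⟨τ, hτ, hr⟩ := ih
    refine Nat.sInf_mem (s := {k | ∃ τ, f τ = x ∧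
      PiNat.res τ (n + 1) = k :: leastPrefix f n x}) ⟨τ n, τ, hτ, ?_⟩
    rw [PiNat.res_succ, hr]

theorem isClopen_res_eq (n : ℕ) (l : List ℕ) : IsClopen {τ : ℕ → ℕ | PiNat.res τ n = l} := by
  induction n generalizing l with
  | zero =>
    by_cases h : l = []
    · simp [h, isClopen_univ]
    · simp [Ne.symm h, isClopen_empty]
  | succ n ih =>
    cases l with
    | nil => simp [PiNat.res_succ, isClopen_empty]
    | cons k l =>
      have : {τ : ℕ → ℕ | PiNat.res τ (n + 1) = k :: l} =
          (fun τ : ℕ → ℕ => τ n) ⁻¹' {k} ∩ {τ | PiNat.res τ n = l} := by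
        ext τ; simp [PiNat.res_succ]
      rw [this]
      exact ((isClopen_discrete {k}).preimage (continuous_apply n)).inter (ih l)

theorem measurableSet_sInf_eq {X : Type*} {m : MeasurableSpace X} {S : X → Set ℕ}
    (hS : ∀ k, MeasurableSet {x | k ∈ S x}) (k : ℕ) : MeasurableSet {x | sInf (S x) = k} := by
  -- The second alternative accounts for `sInf ∅ = 0`.
  have h : ∀ x, sInf (S x) = k ↔
      (k ∈ S x ∧ ∀ j < k, j ∉ S x) ∨ (k = 0 ∧ ∀ j, j ∉ S x) := by
    intro x
    constructor
    · rintro rfl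
      by_cases hne : (S x).Nonempty
      · exact Or.inl ⟨Nat.sInf_mem hne, fun j hj => Nat.notMem_of_lt_sInf hj⟩
      · rw [Set.not_nonempty_iff_eq_empty] at hne
        simp [hne]
    · rintro (⟨h1, h2⟩ | ⟨rfl, h⟩)
      · exact le_antisymm (Nat.sInf_le h1)
          (not_lt.1 fun hlt => h2 _ hlt (Nat.sInf_mem ⟨k, h1⟩))
      · rw [Set.eq_empty_of_forall_notMem h, Nat.sInf_empty]
  simp_rw [h]
  refine ((hS k).inter ?_).union (MeasurableSet.inter (MeasurableSet.const _) ?_)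
  · exact measurableSet_setOfPred.2 (Measurable.forall fun j => Measurable.forall fun _ =>
      (measurableSet_setOfPred.1 (hS j)).not)
  · exact measurableSet_setOfPred.2 (Measurable.forall fun j => (measurableSet_setOfPred.1 (hS j)).not)

variable {X : Type*} [TopologicalSpace X] [TopologicalSpace.MetrizableSpace X] [MeasurableSpace X]
  [OpensMeasurableSpace X]

/-- The prefix is found by asking which cylinders have `x` in their image, and these images are
analytic. -/
theorem measurableSet_leastPrefix_eq {f : (ℕ → ℕ) → X} (hf : Continuous f) (n : ℕ) (l : List ℕ) :
    MeasurableSet[universalCompletion X] {x | leastPrefix f n x = l} := by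
  induction n generalizing l with
  | zero => exact MeasurableSet.const (m := universalCompletion X) ([] = l)
  | succ n ih =>
    cases l with
    | nil => simp [leastPrefix]
    | cons k l =>
      have : {x | leastPrefix f (n + 1) x = k :: l} = {x | leastPrefix f n x = l} ∩
          {x | sInf {k | ∃ τ, f τ = x ∧ PiNat.res τ (n + 1) = k :: l} = k} := by
        ext x
        simp only [leastPrefix, List.cons.injEq, Set.mem_ofPred_eq, Set.mem_inter_iff]
        constructor
        · rintro ⟨h, rfl⟩; exact ⟨rfl, h⟩
        · rintro ⟨rfl, h⟩; exact ⟨h, rfl⟩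
      rw [this]
      refine MeasurableSet.inter (m := universalCompletion X) (ih l)
        (measurableSet_sInf_eq (m := universalCompletion X) (fun j => ?_) k)
      have : {x | j ∈ {k | ∃ τ, f τ = x ∧ PiNat.res τ (n + 1) = k :: l}} =
          f '' {τ | PiNat.res τ (n + 1) = j :: l} := by
        ext x
        simp only [Set.mem_ofPred_eq, Set.mem_image]
        exact exists_congr fun τ => and_comm
      rw [this]
      exact ((isClopen_res_eq _ _).isClosed.measurableSet.analyticSet.image_of_continuous
        hf).measurableSet_universalCompletion

/-- **Jankov–von Neumann**: a continuous map on the Baire space has a universally measurable section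
on its range. -/
theorem exists_univMeasurable_section {f : (ℕ → ℕ) → X} (hf : Continuous f) :
    ∃ L : X → ℕ → ℕ, UnivMeasurable L ∧ ∀ x ∈ Set.range f, f (L x) = x := by
  let L : X → ℕ → ℕ := fun x n => (leastPrefix f (n + 1) x).headI
  have hres : ∀ x n, PiNat.res (L x) n = leastPrefix f n x := by
    intro x n
    induction n with
    | zero => rfl
    | succ n ih => rw [PiNat.res_succ, ih]; rfl
  refine ⟨L, ?_, fun x hx => ?_⟩
  · refine UnivMeasurable.pi fun n =>
      @measurable_to_countable' _ _ _ _ (universalCompletion X) _ fun k => ?_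
    have : (fun x => L x n) ⁻¹' {k} = ⋃ l : List ℕ, {x | leastPrefix f (n + 1) x = k :: l} := by
      ext x
      simp [L, leastPrefix]
    rw [this]
    exact MeasurableSet.iUnion (m := universalCompletion X) fun l => measurableSet_leastPrefix_eq hf _ _
  -- Points of the fibre agreeing with `L x` on longer and longer prefixes converge to it, and
  -- fibres are closed.
  · choose τ hτ hr using exists_res_eq_leastPrefix f hx
    have hlim : Tendsto τ atTop (𝓝 (L x)) := by
      rw [tendsto_pi_nhds]
      intro i
      refine tendsto_const_nhds.congr' ?_
      filter_upwards [eventually_gt_atTop i] with n hn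
      exact (PiNat.res_eq_res.1 ((hr n).trans (hres x n).symm) hn).symm
    refine tendsto_nhds_unique ((hf.tendsto _).comp hlim) ?_
    simp [Function.comp_def, hτ]

/-- Measurable uniformization of analytic sets. -/
theorem _root_.MeasureTheory.AnalyticSet.exists_univMeasurable_selector {Y : Type*}
    [TopologicalSpace Y] [MeasurableSpace Y] (hY : ‹MeasurableSpace Y› ≤ borel Y) [Nonempty Y]
    {A : Set (X × Y)} (hA : AnalyticSet A) :
    ∃ h : X → Y, UnivMeasurable h ∧ ∀ x, (∃ y, (x, y) ∈ A) → (x, h x) ∈ A := by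
  rw [AnalyticSet] at hA
  rcases hA with rfl | ⟨f, hf, rfl⟩
  · exact ⟨fun _ => Classical.arbitrary Y, .of_measurable measurable_const, by simp⟩
  obtain ⟨L, hL, hsec⟩ := exists_univMeasurable_section (continuous_fst.comp hf)
  have hf2 : Measurable fun τ => (f τ).2 := fun s hs => by
    rw [BorelSpace.measurable_eq (α := ℕ → ℕ)]
    exact (continuous_snd.comp hf).borel_measurable (hY s hs)
  refine ⟨fun x => (f (L x)).2, hf2.comp hL, ?_⟩
  rintro x ⟨y, τ, hτ⟩
  refine ⟨L x, Prod.ext (hsec x ⟨τ, ?_⟩) rfl⟩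
  simp [hτ]

/-- Open sets form a generating π-system, and on them evaluation is lower semicontinuous by the
portmanteau theorem. -/
theorem measurableSpace_probabilityMeasure_le_borel (Y : Type*) [TopologicalSpace Y]
    [TopologicalSpace.PseudoMetrizableSpace Y] [MeasurableSpace Y] [BorelSpace Y] :
    ProbabilityMeasure.instMeasurableSpace ≤ borel (ProbabilityMeasure Y) := by
  let _ : MeasurableSpace (ProbabilityMeasure Y) := borel _
  have : BorelSpace (ProbabilityMeasure Y) := ⟨rfl⟩
  have h : Measurable fun P : ProbabilityMeasure Y => (P : Measure Y) := by
    refine Measurable.measure_of_isPiSystem_of_isProbabilityMeasure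
      (BorelSpace.measurable_eq (α := Y)) isPiSystem_isOpen fun s hs => ?_
    refine LowerSemicontinuous.measurable (lowerSemicontinuous_iff_le_liminf.2 fun P => ?_)
    exact ProbabilityMeasure.le_liminf_measure_open_of_tendsto tendsto_id hs
  exact h.comap_le

/-- Measurable selection from a set which is a countable intersection of countable unions of
universally measurable rectangles. -/
theorem exists_univMeasurable_selector_rectangles {Ω E : Type*} [MeasurableSpace Ω]
    [TopologicalSpace E] [PolishSpace E] [MeasurableSpace E] [BorelSpace E] [Nonempty E]
    {A : ℕ → ℕ → Set Ω} {B : ℕ → ℕ → Set E}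
    (hA : ∀ n i, MeasurableSet[universalCompletion Ω] (A n i)) (hB : ∀ n i, MeasurableSet (B n i)) :
    MeasurableSet[universalCompletion Ω] {ω | ∃ y, ∀ n, ∃ i, ω ∈ A n i ∧ y ∈ B n i} ∧
    ∃ h : Ω → E, UnivMeasurable h ∧ ∀ ω, (∃ y, ∀ n, ∃ i, ω ∈ A n i ∧ y ∈ B n i) →
      ∀ n, ∃ i, ω ∈ A n i ∧ h ω ∈ B n i := by
  classical
  -- All memberships are coded in one point of the Baire space. The relation becomes Borel in the
  -- code, and a selector there is composed with `b`.
  let b : Ω → ℕ → ℕ := fun ω m => if ω ∈ A m.unpair.1 m.unpair.2 then 1 else 0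
  have hb : UnivMeasurable b := UnivMeasurable.pi fun m =>
    Measurable.ite (m := universalCompletion Ω) (hA _ _) measurable_const measurable_const
  have hbA : ∀ ω n i, b ω (Nat.pair n i) = 1 ↔ ω ∈ A n i := fun ω n i => by simp [b]
  let S : Set ((ℕ → ℕ) × E) := {p | ∀ n, ∃ i, p.1 (Nat.pair n i) = 1 ∧ p.2 ∈ B n i}
  have hS : MeasurableSet S := by
    have : S = ⋂ n, ⋃ i, {p : (ℕ → ℕ) × E | p.1 (Nat.pair n i) = 1} ∩ Prod.snd ⁻¹' B n i := by
      ext p; simp [S]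
    rw [this]
    refine MeasurableSet.iInter fun n => MeasurableSet.iUnion fun i =>
      MeasurableSet.inter ?_ (measurable_snd (hB n i))
    exact (by fun_prop : Measurable fun p : (ℕ → ℕ) × E => p.1 (Nat.pair n i))
      (measurableSet_singleton 1)
  obtain ⟨h, hh, hsel⟩ := hS.analyticSet.exists_univMeasurable_selector
    (BorelSpace.measurable_eq (α := E)).le
  have hbS : ∀ ω y, (b ω, y) ∈ S ↔ ∀ n, ∃ i, ω ∈ A n i ∧ y ∈ B n i := fun ω y => by
    simp only [S, Set.mem_ofPred_eq, hbA]
  refine ⟨?_, h ∘ b, hh.comp hb, fun ω hω => ?_⟩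
  · have := hb.preimage
      (hS.analyticSet.image_of_continuous continuous_fst).measurableSet_universalCompletion
    convert this using 1
    ext ω
    simp [← hbS]
  · simp_rw [← hbS] at hω ⊢
    exact hsel _ hω

end Selection

/-! ### Path measures and quasi-sure statements -/

section PathMeasure

variable {Ω₁ : Type*}

@[simp]
theorem Path.restrict_extend {t : ℕ} (ω : Path Ω₁ t) (η : Ω₁) :
    (ω.extend η).restrict (Nat.le_succ t) = ω := by
  ext i
  exact Fin.snoc_castSucc (α := fun _ => Ω₁) η ω i

theorem Path.restrict_restrict {r s t : ℕ} (h : r ≤ s) (h' : s ≤ t) (ω : Path Ω₁ t) :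
    (ω.restrict h').restrict h = ω.restrict (h.trans h') := rfl

variable [MeasurableSpace Ω₁]

theorem measurable_extend (t : ℕ) :
    Measurable fun p : Path Ω₁ t × Ω₁ => p.1.extend p.2 := by
  refine measurable_pi_iff.2 fun i => ?_
  induction i using Fin.lastCases with
  | last => simpa [Path.extend] using measurable_snd
  | cast i => simpa [Path.extend, Function.comp_def] using (measurable_pi_apply i).comp measurable_fst

theorem Path.measurable_extend {t : ℕ} (ω : Path Ω₁ t) : Measurable ω.extend :=
  (RobustDP.measurable_extend t).comp measurable_prodMk_left

theorem measurable_restrict {s t : ℕ} (h : s ≤ t) :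
    Measurable fun ω : Path Ω₁ t => ω.restrict h :=
  measurable_pi_iff.2 fun _ => measurable_pi_apply _

/-- Kernels that are universally measurable and take values in the prescribed sets of measures. -/
def IsAdmissible (𝔓 : (t : ℕ) → Path Ω₁ t → Set (ProbabilityMeasure Ω₁)) (T : ℕ)
    (κ : (t : ℕ) → Path Ω₁ t → ProbabilityMeasure Ω₁) : Prop :=
  ∀ t < T, UnivMeasurable (κ t) ∧ ∀ ω, κ t ω ∈ 𝔓 t ω

/-- The law of `ω^{t+1}` given `ω^t`. -/
noncomputable def stepMeasure (κ : (t : ℕ) → Path Ω₁ t → ProbabilityMeasure Ω₁) (t : ℕ)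
    (ω : Path Ω₁ t) : Measure (Path Ω₁ (t + 1)) :=
  (κ t ω : Measure Ω₁).map ω.extend

/-- The measure `κ_0 ⊗ … ⊗ κ_{t-1}` on `Ω^t`. -/
noncomputable def pathMeasure (κ : (t : ℕ) → Path Ω₁ t → ProbabilityMeasure Ω₁) :
    (t : ℕ) → Measure (Path Ω₁ t)
  | 0 => Measure.dirac default
  | t + 1 => (pathMeasure κ t).bind (stepMeasure κ t)

instance (κ : (t : ℕ) → Path Ω₁ t → ProbabilityMeasure Ω₁) (t : ℕ) (ω : Path Ω₁ t) :
    IsProbabilityMeasure (stepMeasure κ t ω) :=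
  Measure.isProbabilityMeasure_map ω.measurable_extend.aemeasurable

theorem pathMeasure_congr {κ κ' : (t : ℕ) → Path Ω₁ t → ProbabilityMeasure Ω₁} {t : ℕ}
    (h : ∀ s < t, κ s = κ' s) : pathMeasure κ t = pathMeasure κ' t := by
  induction t with
  | zero => rfl
  | succ t ih =>
    have hs : stepMeasure κ t = stepMeasure κ' t := by
      funext ω
      rw [stepMeasure, stepMeasure, h t t.lt_succ_self]
    rw [pathMeasure, pathMeasure, ih fun s hs => h s (hs.trans t.lt_succ_self), hs]

theorem measurable_map_extend (t : ℕ) :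
    Measurable fun p : Path Ω₁ t × ProbabilityMeasure Ω₁ =>
      (p.2 : Measure Ω₁).map p.1.extend := by
  let K : ProbabilityTheory.Kernel (Path Ω₁ t × ProbabilityMeasure Ω₁) Ω₁ :=
    ⟨fun p => p.2, measurable_subtype_coe.comp measurable_snd⟩
  have : ProbabilityTheory.IsMarkovKernel K :=
    ⟨fun p => inferInstanceAs (IsProbabilityMeasure (p.2 : Measure Ω₁))⟩
  refine Measure.measurable_measure.2 fun s hs => ?_
  have hm : MeasurableSet {q : (Path Ω₁ t × ProbabilityMeasure Ω₁) × Ω₁ |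
      q.1.1.extend q.2 ∈ s} :=
    ((measurable_extend t).comp (by fun_prop : Measurable
      fun q : (Path Ω₁ t × ProbabilityMeasure Ω₁) × Ω₁ => (q.1.1, q.2))) hs
  convert ProbabilityTheory.Kernel.measurable_kernel_prodMk_left (κ := K) hm using 1
  ext p
  rw [Measure.map_apply p.1.measurable_extend hs]
  rfl

variable [MeasurableSpace.CountablyGenerated Ω₁]
  {𝔓 : (t : ℕ) → Path Ω₁ t → Set (ProbabilityMeasure Ω₁)} {T : ℕ}
  {κ : (t : ℕ) → Path Ω₁ t → ProbabilityMeasure Ω₁}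

theorem UnivMeasurable.aemeasurable_stepMeasure {t : ℕ} (hκ : UnivMeasurable (κ t))
    (μ : Measure (Path Ω₁ t)) [IsProbabilityMeasure μ] : AEMeasurable (stepMeasure κ t) μ :=
  (measurable_map_extend t).comp_aemeasurable (aemeasurable_id.prodMk (hκ.aemeasurable μ))

theorem IsAdmissible.isProbabilityMeasure (hκ : IsAdmissible 𝔓 T κ) {t : ℕ} (ht : t ≤ T) :
    IsProbabilityMeasure (pathMeasure κ t) := by
  induction t with
  | zero => exact inferInstanceAs (IsProbabilityMeasure (Measure.dirac _))
  | succ t ih =>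
    have := ih (Nat.le_of_succ_le ht)
    exact isProbabilityMeasure_bind ((hκ t ht).1.aemeasurable_stepMeasure _)
      (Eventually.of_forall fun _ => inferInstance)

theorem IsAdmissible.aemeasurable_stepMeasure (hκ : IsAdmissible 𝔓 T κ) {t : ℕ} (ht : t < T) :
    AEMeasurable (stepMeasure κ t) (pathMeasure κ t) :=
  have := hκ.isProbabilityMeasure ht.le
  (hκ t ht).1.aemeasurable_stepMeasure _

theorem IsAdmissible.lintegral_stepMeasure (hκ : IsAdmissible 𝔓 T κ) {t : ℕ} (ht : t < T)
    {f : Path Ω₁ (t + 1) → ℝ≥0∞} (hf : AEMeasurable f (pathMeasure κ (t + 1))) :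
    (fun ω => ∫⁻ ω', f ω' ∂stepMeasure κ t ω) =ᵐ[pathMeasure κ t]
      fun ω => ∫⁻ η, f (ω.extend η) ∂(κ t ω : Measure Ω₁) := by
  filter_upwards [(hκ.aemeasurable_stepMeasure ht).ae_of_bind hf] with ω hω
  exact lintegral_map' hω ω.measurable_extend.aemeasurable

theorem IsAdmissible.lintegral_succ (hκ : IsAdmissible 𝔓 T κ) {t : ℕ} (ht : t < T)
    {f : Path Ω₁ (t + 1) → ℝ≥0∞} (hf : AEMeasurable f (pathMeasure κ (t + 1))) :
    ∫⁻ ω, f ω ∂pathMeasure κ (t + 1) =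
      ∫⁻ ω, ∫⁻ η, f (ω.extend η) ∂(κ t ω : Measure Ω₁) ∂pathMeasure κ t :=
  (Measure.lintegral_bind (hκ.aemeasurable_stepMeasure ht) hf).trans
    (lintegral_congr_ae (hκ.lintegral_stepMeasure ht hf))

theorem IsAdmissible.iterInt_eq (hκ : IsAdmissible 𝔓 T κ) {t : ℕ} (ht : t ≤ T)
    {f : Path Ω₁ t → ℝ≥0∞} (hf : AEMeasurable f (pathMeasure κ t)) :
    iterInt κ t f = ∫⁻ ω, f ω ∂pathMeasure κ t := by
  induction t with
  | zero => exact (lintegral_dirac' _ (Subsingleton.measurable (α := Path Ω₁ 0))).symm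
  | succ t ih =>
    rw [hκ.lintegral_succ ht hf, iterInt, ih (Nat.le_of_succ_le ht)]
    refine AEMeasurable.congr ?_ (hκ.lintegral_stepMeasure ht hf)
    exact (Measure.aemeasurable_lintegral hf).comp_aemeasurable (hκ.aemeasurable_stepMeasure ht)

theorem mem_priors_iff {P : ProbabilityMeasure (Path Ω₁ T)} :
    P ∈ priors 𝔓 T ↔ ∃ κ, IsAdmissible 𝔓 T κ ∧ (P : Measure (Path Ω₁ T)) = pathMeasure κ T := by
  refine exists_congr fun κ => and_congr_right fun hκ => ?_
  have h : ∀ A : Set (Path Ω₁ T), MeasurableSet A →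
      iterInt κ T (A.indicator 1) = pathMeasure κ T A := fun A hA => by
    rw [IsAdmissible.iterInt_eq hκ le_rfl (measurable_one.indicator hA).aemeasurable,
      lintegral_indicator_one hA]
  constructor
  · exact fun hP => Measure.ext fun A hA => (hP A hA).trans (h A hA)
  · exact fun hP A hA => by rw [hP, h A hA]

theorem IsAdmissible.map_restrict_succ (hκ : IsAdmissible 𝔓 T κ) {t : ℕ} (ht : t < T) :
    (pathMeasure κ (t + 1)).map (fun ω => ω.restrict (Nat.le_succ t)) = pathMeasure κ t := by
  ext s hs
  have hm := measurable_restrict (Ω₁ := Ω₁) (Nat.le_succ t)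
  have hs1 : Measurable (s.indicator (1 : Path Ω₁ t → ℝ≥0∞)) := measurable_one.indicator hs
  rw [← lintegral_indicator_one hs, lintegral_map hs1 hm]
  refine (hκ.lintegral_succ ht (hs1.comp hm).aemeasurable).trans ?_
  simp [lintegral_indicator_one hs]

theorem IsAdmissible.map_restrict (hκ : IsAdmissible 𝔓 T κ) {m n : ℕ} (hmn : m ≤ n) (hn : n ≤ T) :
    (pathMeasure κ n).map (fun ω => ω.restrict hmn) = pathMeasure κ m := by
  induction n, hmn using Nat.le_induction with
  | base => exact Measure.map_id
  | succ n hmn ih =>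
    rw [← ih (Nat.le_of_succ_le hn), ← hκ.map_restrict_succ hn,
      Measure.map_map (measurable_restrict _) (measurable_restrict _)]
    rfl

theorem IsAdmissible.ae_succ (hκ : IsAdmissible 𝔓 T κ) {t : ℕ} (ht : t < T)
    {p : Path Ω₁ (t + 1) → Prop} (h : ∀ᵐ ω ∂pathMeasure κ (t + 1), p ω) :
    ∀ᵐ ω ∂pathMeasure κ t, ∀ᵐ η ∂(κ t ω : Measure Ω₁), p (ω.extend η) := by
  filter_upwards [Measure.ae_ae_of_ae_bind (hκ.aemeasurable_stepMeasure ht) h] with ω hω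
  exact ae_of_ae_map ω.measurable_extend.aemeasurable hω

/-- Since `p` need not be measurable, image measures alone do not give the forward direction. There,
almost every fibre has full measure and so is nonempty, and `p` ignores the later coordinates. -/
theorem IsAdmissible.ae_restrict_iff (hκ : IsAdmissible 𝔓 T κ) {m n : ℕ} (hmn : m ≤ n)
    (hn : n ≤ T) {p : Path Ω₁ m → Prop} :
    (∀ᵐ ω ∂pathMeasure κ n, p (ω.restrict hmn)) ↔ ∀ᵐ ω ∂pathMeasure κ m, p ω := by
  constructor
  · intro h
    induction n, hmn using Nat.le_induction with
    | base => exact h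
    | succ n hmn ih =>
      refine ih (Nat.le_of_succ_le hn) ?_
      filter_upwards [hκ.ae_succ hn h] with ω hω
      obtain ⟨η, hη⟩ := hω.exists
      rwa [← Path.restrict_restrict hmn (Nat.le_succ n), Path.restrict_extend] at hη
  · intro h
    rw [← hκ.map_restrict hmn hn] at h
    exact ae_of_ae_map (measurable_restrict hmn).aemeasurable h

theorem IsAdmissible.ae_of_ae_ae (hκ : IsAdmissible 𝔓 T κ) {t : ℕ} (ht : t < T)
    {p : Path Ω₁ (t + 1) → Prop} (hp : MeasurableSet[universalCompletion _] {ω | p ω})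
    (h : ∀ᵐ ω ∂pathMeasure κ t, ∀ᵐ η ∂(κ t ω : Measure Ω₁), p (ω.extend η)) :
    ∀ᵐ ω ∂pathMeasure κ (t + 1), p ω := by
  have hnull : NullMeasurableSet {ω | p ω}ᶜ (pathMeasure κ (t + 1)) :=
    (hp _ (hκ.isProbabilityMeasure ht)).compl
  change pathMeasure κ (t + 1) {ω | p ω}ᶜ = 0
  rw [← lintegral_indicator_one₀ hnull]
  refine (hκ.lintegral_succ ht (aemeasurable_const.indicator₀ hnull)).trans ?_
  refine lintegral_eq_zero_of_ae_eq_zero ?_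
  filter_upwards [h] with ω hω
  refine lintegral_eq_zero_of_ae_eq_zero ?_
  filter_upwards [hω] with η hη
  simpa using hη

theorem quasiSurely_restrict_iff {m : ℕ} (hm : m ≤ T) {p : Path Ω₁ m → Prop} :
    QuasiSurely 𝔓 T (fun ω => p (ω.restrict hm)) ↔
      ∀ κ, IsAdmissible 𝔓 T κ → ∀ᵐ ω ∂pathMeasure κ m, p ω := by
  constructor
  · intro h κ hκ
    have hP := hκ.isProbabilityMeasure le_rfl
    exact (hκ.ae_restrict_iff hm le_rfl).1
      (h ⟨pathMeasure κ T, hP⟩ (mem_priors_iff.2 ⟨κ, hκ, rfl⟩))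
  · intro h P hP
    obtain ⟨κ, hκ, hPκ⟩ := mem_priors_iff.1 hP
    rw [hPκ]
    exact (hκ.ae_restrict_iff hm le_rfl).2 (h κ hκ)

end PathMeasure

/-! ### Horizon functions in pointwise form -/

section Horizon

variable {d m : ℕ}

theorem norm_le_eucNorm (x : Pos d m) : ‖x‖ ≤ eucNorm x :=
  (pi_norm_le_iff_of_nonneg (norm_nonneg _)).2 fun i => PiLp.norm_apply_le (WithLp.toLp 2 x) i

theorem exists_eucNorm_le (d m : ℕ) : ∃ c : ℝ, 1 ≤ c ∧ ∀ x : Pos d m, eucNorm x ≤ c * ‖x‖ := by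
  let L := (PiLp.continuousLinearEquiv 2 ℝ
    fun _ : Fin m => EuclideanSpace ℝ (Fin d)).symm.toContinuousLinearMap
  refine ⟨‖L‖ + 1, by linarith [norm_nonneg L], fun x => (L.le_opNorm x).trans ?_⟩
  nlinarith [norm_nonneg x]

theorem horizon_eq_iInf (f : Pos d m → EReal) (x : Pos d m) :
    horizon f x = ⨅ n : ℕ, horizonApprox f x (n + 1) := by
  have hanti : Antitone fun n : ℕ => horizonApprox f x (n + 1) := by
    intro a b hab
    have hab' : (a : ℝ) ≤ b := by exact_mod_cast hab
    refine iSup_mono fun δ => iSup_mono fun y => iSup_mono' fun h => ⟨⟨?_, ?_⟩, le_rfl⟩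
    · have h1 := h.1
      push_cast at h1 ⊢
      linarith
    · refine h.2.trans_le ?_
      push_cast
      exact one_div_le_one_div_of_le (by positivity) (by linarith)
  exact tendsto_nhds_unique ((tendsto_add_atTop_iff_nat 1).2 (horizon_tendsto f x))
    (tendsto_atTop_iInf hanti)

theorem neg_lt_one_div_mul_iff {δ ε : ℝ} (hδ : 0 < δ) (a : EReal) :
    ((-ε : ℝ) : EReal) < ((1 / δ : ℝ) : EReal) * a ↔ ((-(ε * δ) : ℝ) : EReal) < a := by
  have h1 : 0 < 1 / δ := by positivity
  induction a with
  | bot => rw [EReal.coe_mul_bot_of_pos h1]; simp only [not_lt_bot]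
  | top => rw [EReal.coe_mul_top_of_pos h1]; simp only [EReal.coe_lt_top]
  | coe a =>
    rw [← EReal.coe_mul, EReal.coe_lt_coe_iff, EReal.coe_lt_coe_iff, one_div, inv_mul_eq_div,
      lt_div_iff₀ hδ, neg_mul]

/-- Nonnegativity of the horizon function in terms of single points. -/
theorem zero_le_horizon_iff (f : Pos d m → EReal) (x : Pos d m) :
    0 ≤ horizon f x ↔ ∀ ε : ℝ, 0 < ε → ∃ (δ : ℝ) (z : Pos d m), 1 / ε < δ ∧
      ‖x - δ⁻¹ • z‖ < ε ∧ ((-(ε * δ) : ℝ) : EReal) < f z := by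
  rw [horizon_eq_iInf, le_iInf_iff]
  constructor
  · intro h ε hε
    obtain ⟨n, hn⟩ := exists_nat_one_div_lt hε
    have h0 : ((-ε : ℝ) : EReal) < horizonApprox f x (n + 1) :=
      lt_of_lt_of_le (by exact_mod_cast neg_lt_zero.2 hε) (h n)
    simp only [horizonApprox, lt_iSup_iff] at h0
    obtain ⟨δ, y, ⟨h1, h2⟩, h3⟩ := h0
    push_cast at h1 h2
    have hnpos : (0 : ℝ) < n + 1 := by positivity
    have hδ : 0 < δ := hnpos.trans h1
    refine ⟨δ, δ • y, ?_, ?_, (neg_lt_one_div_mul_iff hδ _).1 h3⟩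
    · rw [one_div_lt hnpos hε] at hn
      exact hn.trans h1
    · rw [inv_smul_smul₀ hδ.ne']
      exact (norm_le_eucNorm _).trans_lt (h2.trans hn)
  · intro h n
    obtain ⟨c, hc, hnorm⟩ := exists_eucNorm_le d m
    have hc0 : 0 < c := by linarith
    refine le_of_forall_lt fun b hb => ?_
    obtain ⟨r, hbr, hr⟩ := EReal.lt_iff_exists_real_btwn.1 hb
    have hr0 : r < 0 := by exact_mod_cast hr
    let ε : ℝ := min (-r) (1 / ((n : ℝ) + 1))
    have hε : 0 < ε := lt_min (by linarith) (by positivity)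
    -- The constant `c` compares the Euclidean norm with the sup norm.
    obtain ⟨δ, z, h1, h2, h3⟩ := h (ε / c) (by positivity)
    have hεc : ε / c ≤ ε := div_le_self hε.le hc
    have hδε : 1 / ε < δ := (one_div_le_one_div_of_le (by positivity) hεc).trans_lt h1
    have hδ : 0 < δ := lt_trans (by positivity) hδε
    refine hbr.trans_le (le_trans ?_ (le_iSup₂_of_le δ (δ⁻¹ • z) (le_iSup_of_le ⟨?_, ?_⟩ le_rfl)))
    · rw [smul_inv_smul₀ hδ.ne']
      have h4 : ((-(-r) : ℝ) : EReal) < ((1 / δ : ℝ) : EReal) * f z := by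
        rw [neg_lt_one_div_mul_iff hδ]
        refine lt_of_le_of_lt ?_ h3
        have : ε / c ≤ -r := hεc.trans (min_le_left _ _)
        exact_mod_cast neg_le_neg (mul_le_mul_of_nonneg_right this hδ.le)
      rw [neg_neg] at h4
      exact h4.le
    · push_cast
      refine lt_of_le_of_lt ?_ hδε
      rw [le_one_div (by positivity) hε]
      exact min_le_right _ _
    · push_cast
      calc eucNorm (x - δ⁻¹ • z) ≤ c * ‖x - δ⁻¹ • z‖ := hnorm _
        _ < c * (ε / c) := by gcongr
        _ = ε := by field_simp
        _ ≤ _ := min_le_right _ _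

/-- Nonnegativity of the horizon function of a function with countable effective domain in terms of
countably many conditions. -/
theorem zero_le_horizon_iff_countable {E : Set (Pos d m)} {f : Pos d m → EReal}
    (hf : ∀ z ∉ E, f z = ⊥) (x : Pos d m) :
    0 ≤ horizon f x ↔ ∀ n : ℕ, ∃ i : ℚ × E, (n : ℝ) + 1 < i.1 ∧
      ‖x - (i.1 : ℝ)⁻¹ • (i.2 : Pos d m)‖ < 1 / ((n : ℝ) + 1) ∧
      ((-(1 / ((n : ℝ) + 1) * i.1) : ℝ) : EReal) < f i.2 := by
  rw [zero_le_horizon_iff]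
  constructor
  · intro h n
    have hn : (0 : ℝ) < n + 1 := by positivity
    obtain ⟨δ, z, h1, h2, h3⟩ := h (1 / ((n : ℝ) + 1)) (by positivity)
    rw [one_div_one_div] at h1
    have hz : z ∈ E := by
      by_contra hz
      simp [hf z hz] at h3
    have hδ : δ ≠ 0 := (hn.trans h1).ne'
    -- For fixed `z` all three conditions are open in the scale, so it may be taken rational.
    have e1 : ∀ᶠ r in 𝓝 δ, (n : ℝ) + 1 < r := lt_mem_nhds h1
    have e2 : ∀ᶠ r in 𝓝 δ, ‖x - r⁻¹ • z‖ < 1 / ((n : ℝ) + 1) := by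
      have : ContinuousAt (fun r : ℝ => ‖x - r⁻¹ • z‖) δ :=
        (continuousAt_const.sub ((continuousAt_inv₀ hδ).smul continuousAt_const)).norm
      exact this.eventually (gt_mem_nhds h2)
    have e3 : ∀ᶠ r in 𝓝 δ, ((-(1 / ((n : ℝ) + 1) * r) : ℝ) : EReal) < f z := by
      have : Continuous fun r : ℝ => ((-(1 / ((n : ℝ) + 1) * r) : ℝ) : EReal) :=
        continuous_coe_real_ereal.comp (by fun_prop)
      exact this.continuousAt.eventually (gt_mem_nhds h3)
    obtain ⟨_, ⟨q, rfl⟩, h⟩ :=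
      Dense.inter_nhds_nonempty (Rat.denseRange_cast (𝕜 := ℝ)) (e1.and (e2.and e3))
    exact ⟨(q, ⟨z, hz⟩), h⟩
  · intro h ε hε
    obtain ⟨n, hn⟩ := exists_nat_one_div_lt hε
    obtain ⟨⟨q, z⟩, h1, h2, h3⟩ := h n
    have hnpos : (0 : ℝ) < n + 1 := by positivity
    refine ⟨q, z, ?_, h2.trans hn, lt_of_le_of_lt ?_ h3⟩
    · rw [one_div_lt hnpos hε] at hn
      exact hn.trans h1
    · exact_mod_cast neg_le_neg (mul_le_mul_of_nonneg_right hn.le (hnpos.trans h1).le)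

theorem zero_le_horizon_zero {f : Pos d m → EReal} (hf : ⊥ < f 0) : 0 ≤ horizon f 0 := by
  rw [zero_le_horizon_iff]
  intro ε hε
  obtain ⟨r, -, hr⟩ := EReal.lt_iff_exists_real_btwn.1 hf
  refine ⟨max (1 / ε) (-r / ε) + 1, 0, by linarith [le_max_left (1 / ε) (-r / ε)], by simpa, ?_⟩
  refine lt_of_le_of_lt (EReal.coe_le_coe_iff.2 ?_) hr
  have h1 : -r / ε ≤ max (1 / ε) (-r / ε) + 1 := by linarith [le_max_right (1 / ε) (-r / ε)]
  rw [div_le_iff₀ hε] at h1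
  linarith

/-- Each coordinate projection is a separated subset of a separable space, and `D` lies in their
finite product. -/
theorem GridCondition.countable {D : Set (Pos d m)} (hD : GridCondition D) : D.Countable := by
  obtain ⟨ε, hε, hsep⟩ := hD
  have h : ∀ i, ((fun x : Pos d m => x i) '' D).Countable := by
    intro i
    refine Set.PairwiseDisjoint.countable_of_isOpen
      (s := fun a : EuclideanSpace ℝ (Fin d) => Metric.ball a (ε / 2)) ?_
      (fun _ _ => Metric.isOpen_ball) (fun a _ => ⟨a, Metric.mem_ball_self (by positivity)⟩)
    rintro _ ⟨x, hx, rfl⟩ _ ⟨y, hy, rfl⟩ hxy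
    refine Metric.ball_disjoint_ball ?_
    rw [dist_eq_norm]
    linarith [hsep i x hx y hy hxy]
  have hsub : D ⊆ Set.univ.pi fun i => (fun x : Pos d m => x i) '' D :=
    fun x hx i _ => ⟨x, hx, rfl⟩
  exact (Set.countable_univ_pi h).mono hsub

theorem Pos.extend_sub_smul (x z : Pos d m) (h y : EuclideanSpace ℝ (Fin d)) (r : ℝ) :
    x.extend h - r • z.extend y = (x - r • z).extend (h - r • y) := by
  ext i : 1
  induction i using Fin.lastCases with
  | last => simp [Pos.extend]
  | cast i => simp [Pos.extend]

theorem Pos.norm_extend_lt_iff (x : Pos d m) (h : EuclideanSpace ℝ (Fin d)) {r : ℝ} (hr : 0 < r) :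
    ‖x.extend h‖ < r ↔ ‖x‖ < r ∧ ‖h‖ < r := by
  rw [pi_norm_lt_iff hr, pi_norm_lt_iff hr, Fin.forall_fin_succ']
  simp [Pos.extend]

theorem Pos.extend_eq_zero_iff (x : Pos d m) (h : EuclideanSpace ℝ (Fin d)) :
    x.extend h = 0 ↔ x = 0 ∧ h = 0 := by
  simp [funext_iff, Fin.forall_fin_succ', Pos.extend]

theorem Pos.exists_extend (z : Pos d (m + 1)) : ∃ (x : Pos d m) (h : _), x.extend h = z :=
  ⟨_, _, Fin.snoc_init_self (α := fun _ => EuclideanSpace ℝ (Fin d)) z⟩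

/-- Partial maximization and horizon functions: either the maximizers stay bounded after rescaling,
or there is a nonzero direction of recession in the last variable only. -/
theorem exists_zero_le_horizon_of_iSup {φ : Pos d (m + 1) → EReal} {x : Pos d m}
    (hx : 0 ≤ horizon (fun x => ⨆ y, φ (x.extend y)) x) :
    (∃ h, 0 ≤ horizon φ (x.extend h)) ∨ ∃ h, ‖h‖ = 1 ∧ 0 ≤ horizon φ (Pos.extend 0 h) := by
  rw [zero_le_horizon_iff] at hx
  let ε : ℕ → ℝ := fun n => 1 / ((n : ℝ) + 1)
  have hε : ∀ n, 0 < ε n := fun n => by positivity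
  have hε0 : Tendsto ε atTop (𝓝 0) := tendsto_one_div_add_atTop_nhds_zero_nat
  choose δ z h1 h2 h3 using fun n => hx (ε n) (hε n)
  simp only [lt_iSup_iff] at h3
  choose y h3 using h3
  have hδ : ∀ n, 0 < δ n := fun n => (one_div_pos.2 (hε n)).trans (h1 n)
  let v : ℕ → EuclideanSpace ℝ (Fin d) := fun n => (δ n)⁻¹ • y n
  by_cases hlim : Tendsto (fun n => ‖v n‖) atTop atTop
  · right
    let u : ℕ → EuclideanSpace ℝ (Fin d) := fun n => ‖v n‖⁻¹ • v n
    have hu : ∃ᶠ n in atTop, u n ∈ Metric.sphere (0 : EuclideanSpace ℝ (Fin d)) 1 := by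
      refine Eventually.frequently ?_
      filter_upwards [hlim.eventually_gt_atTop 0] with n hn
      simp [u, norm_smul, hn.ne']
    obtain ⟨h, hh, σ, hσ, hconv⟩ :=
      tendsto_subseq_of_frequently_bounded Metric.isBounded_sphere hu
    rw [Metric.isClosed_sphere.closure_eq, mem_sphere_zero_iff_norm] at hh
    refine ⟨h, hh, (zero_le_horizon_iff _ _).2 fun e he => ?_⟩
    have e1 : ∀ᶠ k in atTop, ε (σ k) < e :=
      (hε0.comp hσ.tendsto_atTop).eventually (gt_mem_nhds he)
    have e2 : ∀ᶠ k in atTop, ‖h - u (σ k)‖ < e := by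
      have := (tendsto_const_nhds (x := h)).sub hconv
      rw [sub_self] at this
      have := this.norm
      rw [norm_zero] at this
      exact this.eventually (gt_mem_nhds he)
    have e3 : ∀ᶠ k in atTop, max 1 ((‖x‖ + 1) / e) < ‖v (σ k)‖ :=
      (hlim.comp hσ.tendsto_atTop).eventually_gt_atTop _
    obtain ⟨k, k1, k2, k3⟩ := (e1.and (e2.and e3)).exists
    set n := σ k
    have hv1 : 1 < ‖v n‖ := (le_max_left _ _).trans_lt k3
    have hv0 : 0 < ‖v n‖ := one_pos.trans hv1
    have hδv : δ n < δ n * ‖v n‖ := lt_mul_of_one_lt_right (hδ n) hv1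
    -- At the larger scale `δ n * ‖v n‖` the first block tends to zero, the last one is `u n`, and
    -- the required lower bound on `φ` only weakens.
    refine ⟨δ n * ‖v n‖, (z n).extend (y n), ?_, ?_, lt_of_le_of_lt ?_ (h3 n)⟩
    · exact (one_div_le_one_div_of_le (hε n) k1.le).trans_lt ((h1 n).trans hδv)
    · rw [Pos.extend_sub_smul, Pos.norm_extend_lt_iff _ _ he]
      have hinv : (δ n * ‖v n‖)⁻¹ = ‖v n‖⁻¹ * (δ n)⁻¹ := by rw [mul_inv, mul_comm]
      constructor
      · rw [zero_sub, norm_neg, hinv, mul_smul, norm_smul, norm_inv, norm_norm, inv_mul_lt_iff₀ hv0]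
        have hz : ‖(δ n)⁻¹ • z n‖ < ‖x‖ + 1 := by
          have hle1 : ε n ≤ 1 := by
            simp only [ε]
            rw [div_le_one (by positivity)]
            linarith [Nat.cast_nonneg (α := ℝ) n]
          have := norm_sub_rev x ((δ n)⁻¹ • z n) ▸ h2 n
          have := norm_le_norm_add_norm_sub' ((δ n)⁻¹ • z n) x
          linarith
        have : (‖x‖ + 1) / e < ‖v n‖ := (le_max_right _ _).trans_lt k3
        rw [div_lt_iff₀ he] at this
        linarith
      · rw [hinv, mul_smul]
        exact k2
    · refine EReal.coe_le_coe_iff.2 (neg_le_neg ?_)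
      exact mul_le_mul k1.le hδv.le (hδ n).le he.le
  · left
    have hfreq : ∃ R : ℝ, ∃ᶠ n in atTop, v n ∈ Metric.closedBall 0 R := by
      simp only [tendsto_atTop, not_forall, not_eventually] at hlim
      obtain ⟨R, hR⟩ := hlim
      exact ⟨R, hR.mono fun n hn => mem_closedBall_zero_iff.2 (not_le.1 hn).le⟩
    obtain ⟨R, hR⟩ := hfreq
    obtain ⟨h, -, σ, hσ, hconv⟩ :=
      tendsto_subseq_of_frequently_bounded Metric.isBounded_closedBall hR
    refine ⟨h, (zero_le_horizon_iff _ _).2 fun e he => ?_⟩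
    have e1 : ∀ᶠ k in atTop, ε (σ k) < e :=
      (hε0.comp hσ.tendsto_atTop).eventually (gt_mem_nhds he)
    have e2 : ∀ᶠ k in atTop, ‖h - v (σ k)‖ < e := by
      have := (tendsto_const_nhds (x := h)).sub hconv
      rw [sub_self] at this
      have := this.norm
      rw [norm_zero] at this
      exact this.eventually (gt_mem_nhds he)
    obtain ⟨k, k1, k2⟩ := (e1.and e2).exists
    refine ⟨δ (σ k), (z (σ k)).extend (y (σ k)), ?_, ?_, lt_of_le_of_lt ?_ (h3 (σ k))⟩
    · exact (one_div_le_one_div_of_le (hε _) k1.le).trans_lt (h1 _)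
    · rw [Pos.extend_sub_smul, Pos.norm_extend_lt_iff _ _ he]
      exact ⟨(h2 _).trans k1, k2⟩
    · exact EReal.coe_le_coe_iff.2 (neg_le_neg (mul_le_mul_of_nonneg_right k1.le (hδ _).le))

end Horizon

/-! ### Expectations of functions bounded above -/

section Expectation

variable {X : Type*} [MeasurableSpace X]

/-- All four terms are nonnegative, so the identity can be integrated without cancelling infinities.
-/
theorem toENNReal_add_const_sub {C : ℝ} (hC : 0 ≤ C) {a : EReal} (ha : a ≤ C) :
    a.toENNReal + ((C : EReal) - a).toENNReal = ENNReal.ofReal C + (-a).toENNReal := by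
  induction a with
  | bot => simp
  | top => simp at ha
  | coe a =>
    have ha' : a ≤ C := by exact_mod_cast ha
    rw [← EReal.coe_sub, ← EReal.coe_neg]
    simp only [EReal.real_coe_toENNReal]
    rcases le_total 0 a with h | h
    · rw [ENNReal.ofReal_of_nonpos (neg_nonpos.2 h), add_zero,
        ← ENNReal.ofReal_add h (sub_nonneg.2 ha')]
      congr 1; ring
    · rw [ENNReal.ofReal_of_nonpos h, zero_add, ← ENNReal.ofReal_add hC (neg_nonneg.2 h)]
      rfl

/-- The expectation of a function which is bounded above by `C ≥ 0`. -/
theorem expect_eq_sub {P : Measure X} [IsProbabilityMeasure P] {f : X → EReal}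
    (hf : AEMeasurable f P) {C : ℝ} (hC : 0 ≤ C) (hfC : ∀ x, f x ≤ C) :
    expect P f = (C : EReal) - ((∫⁻ x, ((C : EReal) - f x).toENNReal ∂P : ℝ≥0∞) : EReal) := by
  have hpos : AEMeasurable (fun x => (f x).toENNReal) P :=
    measurable_id.ereal_toENNReal.comp_aemeasurable hf
  have h : ∫⁻ x, (f x).toENNReal ∂P + ∫⁻ x, ((C : EReal) - f x).toENNReal ∂P =
      ENNReal.ofReal C + ∫⁻ x, (-f x).toENNReal ∂P := by
    rw [← lintegral_add_left' hpos]
    simp_rw [toENNReal_add_const_sub hC (hfC _)]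
    rw [lintegral_add_left' aemeasurable_const, lintegral_const, measure_univ, mul_one]
  have hfin : ∫⁻ x, (f x).toENNReal ∂P ≠ ⊤ := by
    refine ne_top_of_le_ne_top (b := ENNReal.ofReal C) ENNReal.ofReal_ne_top ?_
    calc ∫⁻ x, (f x).toENNReal ∂P ≤ ∫⁻ _, ENNReal.ofReal C ∂P :=
          lintegral_mono fun x => EReal.toENNReal_le_toENNReal (hfC x)
      _ = _ := by simp
  rw [expect]
  generalize ∫⁻ x, (f x).toENNReal ∂P = A at *
  generalize ∫⁻ x, ((C : EReal) - f x).toENNReal ∂P = I at *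
  generalize ∫⁻ x, (-f x).toENNReal ∂P = B at *
  lift A to NNReal using hfin
  induction B with
  | top =>
    have : I = ⊤ := by simpa using h
    simp [this, EReal.sub_top]
  | coe B =>
    have hI : I ≠ ⊤ := by
      rintro rfl
      simp [ENNReal.ofReal] at h
      exact absurd h.symm (ENNReal.add_ne_top.2 ⟨ENNReal.coe_ne_top, ENNReal.coe_ne_top⟩)
    lift I to NNReal using hI
    lift C to NNReal using hC
    rw [ENNReal.ofReal_coe_nnreal] at h
    have h' : (A : ℝ) + I = C + B := by exact_mod_cast h
    have : (A : ℝ) - B = C - I := by linarith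
    change ((A : ℝ) : EReal) - ((B : ℝ) : EReal) = ((C : ℝ) : EReal) - ((I : ℝ) : EReal)
    rw [← EReal.coe_sub, ← EReal.coe_sub, this]

theorem sub_coe_ennreal_lt_iff (C c : ℝ) (I : ℝ≥0∞) :
    (C : EReal) - (I : EReal) < c ↔ C < c ∨ ENNReal.ofReal (C - c) < I := by
  induction I with
  | top => simp [EReal.sub_top]
  | coe I =>
    have : (((I : NNReal) : ℝ≥0∞) : EReal) = ((I : ℝ) : EReal) := rfl
    rw [this, ← EReal.coe_sub, EReal.coe_lt_coe_iff]
    rcases lt_or_ge C c with h | h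
    · simp only [h, true_or, iff_true]
      linarith [I.coe_nonneg]
    · simp only [h.not_gt, false_or]
      rw [ENNReal.ofReal_lt_coe_iff (sub_nonneg.2 h)]
      constructor <;> intro <;> linarith

theorem lt_sub_coe_ennreal (C c : ℝ) {I : ℝ≥0∞} (h : (c : EReal) < (C : EReal) - (I : EReal)) :
    I < ENNReal.ofReal (C - c) := by
  induction I with
  | top => simp [EReal.sub_top] at h
  | coe I =>
    have : (((I : NNReal) : ℝ≥0∞) : EReal) = ((I : ℝ) : EReal) := rfl
    rw [this, ← EReal.coe_sub, EReal.coe_lt_coe_iff] at h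
    rw [← ENNReal.ofReal_coe_nnreal]
    exact (ENNReal.ofReal_lt_ofReal_iff (by linarith [I.coe_nonneg])).2 (by linarith)

theorem LowerSemianalytic.analyticSet_lt_sub {Y : Type*} [TopologicalSpace Y] [PolishSpace Y]
    {f : Y → EReal} (hf : LowerSemianalytic f) (C : ℝ) (c : ℝ≥0∞) :
    AnalyticSet {y | c < ((C : EReal) - f y).toENNReal} := by
  induction c with
  | top => simpa using analyticSet_empty
  | coe c =>
    convert hf (C - c) using 1
    ext y
    simp only [Set.mem_ofPred_eq]
    induction f y with
    | bot => simp [EReal.bot_lt_coe, -EReal.coe_sub]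
    | top => simp
    | coe a =>
      rw [← EReal.coe_sub, EReal.real_coe_toENNReal, ENNReal.ofReal, ENNReal.coe_lt_coe,
        Real.lt_toNNReal_iff_coe_lt, EReal.coe_lt_coe_iff]
      constructor <;> intro <;> linarith

theorem LowerSemianalytic.univMeasurable {Y : Type*} [TopologicalSpace Y] [PolishSpace Y]
    [MeasurableSpace Y] [BorelSpace Y] {f : Y → EReal} (hf : LowerSemianalytic f) :
    UnivMeasurable f := by
  have hcoe : ∀ c : ℝ, MeasurableSet[universalCompletion Y] (f ⁻¹' Set.Iio (c : EReal)) :=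
    fun c => (hf c).measurableSet_universalCompletion
  refine measurable_of_Iio (mδ := universalCompletion Y) fun c => ?_
  have : f ⁻¹' Set.Iio c = ⋃ q : {q : ℚ // ((q : ℝ) : EReal) ≤ c},
      f ⁻¹' Set.Iio ((q : ℝ) : EReal) := by
    ext y
    simp only [Set.mem_preimage, Set.mem_Iio, Set.mem_iUnion, Subtype.exists, exists_prop]
    constructor
    · intro h
      obtain ⟨q, h1, h2⟩ := EReal.lt_iff_exists_rat_btwn.1 h
      exact ⟨q, h2.le, h1⟩
    · rintro ⟨q, h1, h2⟩
      exact h2.trans_le h1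
  rw [this]
  exact MeasurableSet.iUnion (m := universalCompletion Y) fun q => hcoe q

/-- A witness for `ψ` at precision `γ ≤ ε` makes the mean of `C - f` less than `C + γδ`, while `C -
f ≥ C + εδ` wherever precision `ε` fails. Markov's inequality bounds the measure of the failure set
by a multiple of `γ`, which is arbitrarily small. -/
theorem ae_zero_le_horizon {d m : ℕ} {P : Measure X} [IsProbabilityMeasure P]
    {f : X → Pos d m → EReal} (hf : ∀ z, AEMeasurable (fun η => f η z) P) {C : ℝ}
    (hC : 0 ≤ C) (hfC : ∀ η z, f η z ≤ C) {ψ : Pos d m → EReal}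
    (hψ : ∀ z, ψ z ≤ expect P fun η => f η z) {x : Pos d m} (hx : 0 ≤ horizon ψ x) :
    ∀ᵐ η ∂P, 0 ≤ horizon (f η) x := by
  rw [zero_le_horizon_iff] at hx
  let bad : ℝ → Set X := fun ε => {η | ¬ ∃ (δ : ℝ) (z : Pos d m), 1 / ε < δ ∧
      ‖x - δ⁻¹ • z‖ < ε ∧ ((-(ε * δ) : ℝ) : EReal) < f η z}
  have key : ∀ ε : ℝ, 0 < ε → P (bad ε) = 0 := by
    intro ε hε
    have hbound : ∀ γ : ℝ, 0 < γ → γ ≤ ε → ε * (P (bad ε)).toReal ≤ γ * (C + 1) := by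
      intro γ hγ hγε
      obtain ⟨δ, z, h1, h2, h3⟩ := hx γ hγ
      have hδ : 0 < δ := (one_div_pos.2 hγ).trans h1
      have hI := h3.trans_le (hψ z)
      rw [expect_eq_sub (hf z) hC fun η => hfC η z] at hI
      replace hI := lt_sub_coe_ennreal _ _ hI
      have hsub : bad ε ⊆ {η | ENNReal.ofReal (C + ε * δ) ≤ ((C : EReal) - f η z).toENNReal} := by
        intro η hη
        simp only [bad, Set.mem_ofPred_eq, not_exists, not_and, not_lt] at hη
        have := hη δ z ((one_div_le_one_div_of_le hγ hγε).trans_lt h1) (h2.trans_le hγε)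
        rw [Set.mem_ofPred_eq, ← EReal.real_coe_toENNReal]
        refine EReal.toENNReal_le_toENNReal ?_
        calc ((C + ε * δ : ℝ) : EReal) = (C : EReal) - ((-(ε * δ) : ℝ) : EReal) := by
              rw [← EReal.coe_sub]; congr 1; ring
          _ ≤ _ := EReal.sub_le_sub le_rfl this
      have hmeas : AEMeasurable (fun η => ((C : EReal) - f η z).toENNReal) P :=
        (measurable_id.const_sub (C : EReal)).ereal_toENNReal.comp_aemeasurable (hf z)
      have hmarkov := (mul_le_mul_right (measure_mono hsub) _).trans
        ((mul_meas_ge_le_lintegral₀ hmeas _).trans hI.le)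
      have hreal := ENNReal.toReal_mono ENNReal.ofReal_ne_top hmarkov
      have hεδ : 0 < ε * δ := by positivity
      have hγδ : 0 < γ * δ := by positivity
      rw [ENNReal.toReal_mul, ENNReal.toReal_ofReal (by linarith),
        ENNReal.toReal_ofReal (by linarith)] at hreal
      set p := (P (bad ε)).toReal
      have hp : 0 ≤ p := ENNReal.toReal_nonneg
      rw [div_lt_iff₀ hγ] at h1
      -- From `(C + εδ) p ≤ C + γδ` and `γδ > 1`, which gives `C ≤ C γδ`.
      have h4 : ε * p * δ ≤ γ * (C + 1) * δ := by nlinarith [mul_nonneg hC hp]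
      exact le_of_mul_le_mul_right h4 hδ
    have hzero : ε * (P (bad ε)).toReal ≤ 0 := by
      refine le_of_forall_pos_le_add fun e he => ?_
      rw [zero_add]
      have hC1 : 0 < C + 1 := by linarith
      refine (hbound (min ε (e / (C + 1))) (lt_min hε (by positivity)) (min_le_left _ _)).trans ?_
      calc min ε (e / (C + 1)) * (C + 1) ≤ e / (C + 1) * (C + 1) := by
            gcongr; exact min_le_right _ _
        _ = e := by field_simp
    have : (P (bad ε)).toReal = 0 :=
      le_antisymm (nonpos_of_mul_nonpos_right hzero hε) ENNReal.toReal_nonneg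
    exact ((ENNReal.toReal_eq_zero_iff _).1 this).resolve_right (measure_ne_top _ _)
  have hall : ∀ᵐ η ∂P, ∀ n : ℕ, η ∉ bad (1 / ((n : ℝ) + 1)) :=
    ae_all_iff.2 fun n => measure_eq_zero_iff_ae_notMem.1 (key _ (by positivity))
  filter_upwards [hall] with η hη
  rw [zero_le_horizon_iff]
  intro ε hε
  obtain ⟨n, hn⟩ := exists_nat_one_div_lt hε
  obtain ⟨δ, z, h1, h2, h3⟩ := not_not.1 (hη n)
  have hn0 : (0 : ℝ) < 1 / ((n : ℝ) + 1) := by positivity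
  have hδ : 0 < δ := (one_div_pos.2 hn0).trans h1
  refine ⟨δ, z, (one_div_le_one_div_of_le hn0 hn.le).trans_lt h1, h2.trans hn,
    lt_of_le_of_lt ?_ h3⟩
  exact EReal.coe_le_coe_iff.2 (neg_le_neg (mul_le_mul_of_nonneg_right hn.le hδ.le))

end Expectation

/-! ### Measurability and selection for horizon conditions -/

section Horizon

variable {X : Type*} [MeasurableSpace X] {d m : ℕ}

theorem measurableSet_zero_le_horizon {E : Set (Pos d m)} (hE : E.Countable)
    {f : X → Pos d m → EReal} (hf : ∀ z, UnivMeasurable fun ω => f ω z)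
    (hfE : ∀ ω, ∀ z ∉ E, f ω z = ⊥) {H : X → Pos d m} (hH : UnivMeasurable H) :
    MeasurableSet[universalCompletion X] {ω | 0 ≤ horizon (f ω) (H ω)} := by
  have := hE.to_subtype
  simp_rw [zero_le_horizon_iff_countable (hfE _), Set.ofPred_forall, Set.ofPred_exists]
  refine MeasurableSet.iInter (m := universalCompletion X) fun n =>
    MeasurableSet.iUnion (m := universalCompletion X) fun i => ?_
  refine MeasurableSet.inter (m := universalCompletion X)
    (MeasurableSet.const (m := universalCompletion X) _)
    (MeasurableSet.inter (m := universalCompletion X) ?_ ?_)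
  · exact hH (measurableSet_lt (by fun_prop :
      Measurable fun x : Pos d m => ‖x - (i.1 : ℝ)⁻¹ • (i.2 : Pos d m)‖) measurable_const)
  · exact hf i.2 measurableSet_Ioi

/-- Universally measurable selection of the last variable in sets defined by nonnegativity of a
horizon function. -/
theorem exists_univMeasurable_zero_le_horizon {E : Set (Pos d (m + 1))} (hE : E.Countable)
    {f : X → Pos d (m + 1) → EReal} (hf : ∀ z, UnivMeasurable fun ω => f ω z)
    (hfE : ∀ ω, ∀ z ∉ E, f ω z = ⊥) {H : X → Pos d m} (hH : UnivMeasurable H)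
    {K : Set (EuclideanSpace ℝ (Fin d))} (hK : MeasurableSet K) :
    MeasurableSet[universalCompletion X] {ω | ∃ h ∈ K, 0 ≤ horizon (f ω) ((H ω).extend h)} ∧
    ∃ s : X → EuclideanSpace ℝ (Fin d), UnivMeasurable s ∧
      ∀ ω, (∃ h ∈ K, 0 ≤ horizon (f ω) ((H ω).extend h)) →
        s ω ∈ K ∧ 0 ≤ horizon (f ω) ((H ω).extend (s ω)) := by
  -- An empty domain leaves nothing to enumerate, and then no horizon value is nonnegative.
  rcases E.eq_empty_or_nonempty with rfl | hne
  · have hn : ∀ ω h, ¬ 0 ≤ horizon (f ω) ((H ω).extend h) := fun ω h h0 => by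
      obtain ⟨i, -⟩ := (zero_le_horizon_iff_countable (hfE ω) _).1 h0 0
      exact i.2.2
    simp only [hn, and_false, exists_false, false_implies, implies_true, and_true]
    exact ⟨MeasurableSet.const (m := universalCompletion X) _, 0, .of_measurable measurable_const⟩
  have := hE.to_subtype
  have := hne.to_subtype
  obtain ⟨e, he⟩ := exists_surjective_nat (ℚ × E)
  choose zx zh hz using Pos.exists_extend (d := d) (m := m)
  -- In the sup norm the nearness condition splits into one on `H ω` and one on `h`, which yields
  -- rectangles.
  let A : ℕ → ℕ → Set X := fun n i => {ω | (n : ℝ) + 1 < (e i).1 ∧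
    ‖H ω - ((e i).1 : ℝ)⁻¹ • zx (e i).2‖ < 1 / ((n : ℝ) + 1) ∧
    ((-(1 / ((n : ℝ) + 1) * (e i).1) : ℝ) : EReal) < f ω (e i).2}
  let B : ℕ → ℕ → Set (EuclideanSpace ℝ (Fin d)) := fun n i => K ∩
    {h | ‖h - ((e i).1 : ℝ)⁻¹ • zh (e i).2‖ < 1 / ((n : ℝ) + 1)}
  have hA : ∀ n i, MeasurableSet[universalCompletion X] (A n i) := by
    intro n i
    refine MeasurableSet.inter (m := universalCompletion X)
      (MeasurableSet.const (m := universalCompletion X) _)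
      (MeasurableSet.inter (m := universalCompletion X) ?_ ?_)
    · exact hH (measurableSet_lt (by fun_prop :
        Measurable fun x : Pos d m => ‖x - ((e i).1 : ℝ)⁻¹ • zx (e i).2‖) measurable_const)
    · exact hf (e i).2 measurableSet_Ioi
  have hB : ∀ n i, MeasurableSet (B n i) := fun n i =>
    hK.inter (measurableSet_lt (by fun_prop) measurable_const)
  have key : ∀ ω h, (∀ n, ∃ i, ω ∈ A n i ∧ h ∈ B n i) ↔
      h ∈ K ∧ 0 ≤ horizon (f ω) ((H ω).extend h) := by
    intro ω h
    have hnorm : ∀ (n : ℕ) (q : ℚ) (z : Pos d (m + 1)),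
        ‖(H ω).extend h - (q : ℝ)⁻¹ • z‖ < 1 / ((n : ℝ) + 1) ↔
        ‖H ω - (q : ℝ)⁻¹ • zx z‖ < 1 / ((n : ℝ) + 1) ∧
        ‖h - (q : ℝ)⁻¹ • zh z‖ < 1 / ((n : ℝ) + 1) := fun n q z => by
      nth_rewrite 1 [← hz z]
      rw [Pos.extend_sub_smul, Pos.norm_extend_lt_iff _ _ (by positivity)]
    rw [zero_le_horizon_iff_countable (hfE ω)]
    simp_rw [he.exists, hnorm]
    simp only [A, B, Set.mem_ofPred_eq, Set.mem_inter_iff]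
    constructor
    · intro hall
      obtain ⟨i, -, hi, -⟩ := hall 0
      refine ⟨hi, fun n => ?_⟩
      obtain ⟨i, ⟨h1, h2, h3⟩, -, h4⟩ := hall n
      exact ⟨i, h1, ⟨h2, h4⟩, h3⟩
    · rintro ⟨hhK, hall⟩ n
      obtain ⟨i, h1, ⟨h2, h4⟩, h3⟩ := hall n
      exact ⟨i, ⟨h1, h2, h3⟩, hhK, h4⟩
  have hsel := exists_univMeasurable_selector_rectangles hA hB
  simp only [key] at hsel
  exact hsel

end Horizon

/-! ### The conditional worst-case expectation -/

section DynamicProgramming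

variable {Ω₁ : Type*} [MeasurableSpace Ω₁] {d T t : ℕ}
  {𝔓 : (t : ℕ) → Path Ω₁ t → Set (ProbabilityMeasure Ω₁)} {F : Integrand Ω₁ d (t + 1)} {C : ℝ}

theorem UnivMeasurable.aemeasurable_comp_extend {f : Path Ω₁ (t + 1) → EReal}
    (hf : UnivMeasurable f) (ω : Path Ω₁ t) (P : Measure Ω₁) [IsProbabilityMeasure P] :
    AEMeasurable (fun η => f (ω.extend η)) P := by
  have hm := ω.measurable_extend
  have := Measure.isProbabilityMeasure_map (μ := P) hm.aemeasurable
  exact (hf.aemeasurable (P.map ω.extend)).comp_measurable hm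

/-- This exhibits sublevel sets as projections, hence as analytic sets. The alternative `C < c` is
separate because `ENNReal.ofReal` truncates negative values. -/
theorem condInf_lt_iff (hC : 0 ≤ C) (hFC : ∀ ω x, F ω x ≤ C) {x : Pos d (t + 1)}
    (hF : UnivMeasurable fun ω => F ω x) (ω : Path Ω₁ t) (c : ℝ) :
    condInf 𝔓 t F ω x < c ↔ ∃ P ∈ 𝔓 t ω, C < c ∨ ENNReal.ofReal (C - c) <
      ∫⁻ η, ((C : EReal) - F (ω.extend η) x).toENNReal ∂(P : Measure Ω₁) := by
  simp only [condInf, iInf_lt_iff, exists_prop]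
  refine exists_congr fun P => and_congr_right fun _ => ?_
  rw [expect_eq_sub (hF.aemeasurable_comp_extend ω P) hC fun η => hFC _ _, sub_coe_ennreal_lt_iff]

theorem condInf_le_expect {ω : Path Ω₁ t} {P : ProbabilityMeasure Ω₁} (hP : P ∈ 𝔓 t ω)
    (x : Pos d (t + 1)) : condInf 𝔓 t F ω x ≤ expect (P : Measure Ω₁) fun η => F (ω.extend η) x :=
  iInf₂_le P hP

theorem condInf_eq_bot {ω : Path Ω₁ t} (hne : (𝔓 t ω).Nonempty) {x : Pos d (t + 1)}
    (hF : ∀ ω, F ω x = ⊥) : condInf 𝔓 t F ω x = ⊥ := by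
  obtain ⟨P, hP⟩ := hne
  refine le_bot_iff.1 ((condInf_le_expect hP x).trans ?_)
  simp [expect, hF]

variable [TopologicalSpace Ω₁] [PolishSpace Ω₁] [BorelSpace Ω₁]

/-- The models under which a nonnegative function has a large conditional integral form an analytic
set. -/
theorem analyticSet_lt_lintegral_extend
    (h𝔓 : AnalyticSet {p : Path Ω₁ t × ProbabilityMeasure Ω₁ | p.2 ∈ 𝔓 t p.1})
    {g : Path Ω₁ (t + 1) → ℝ≥0∞} (hg : ∀ c, AnalyticSet {ω | c < g ω}) (a : ℝ≥0∞) :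
    AnalyticSet {p : Path Ω₁ t × ProbabilityMeasure Ω₁ | p.2 ∈ 𝔓 t p.1 ∧
      a < ∫⁻ η, g (p.1.extend η) ∂(p.2 : Measure Ω₁)} := by
  rw [AnalyticSet] at h𝔓
  rcases h𝔓 with h | ⟨γ, hγ, hrange⟩
  · have hemp : ∀ p : Path Ω₁ t × ProbabilityMeasure Ω₁, p.2 ∉ 𝔓 t p.1 := fun p hp =>
      (h ▸ hp : p ∈ (∅ : Set _))
    simpa [hemp] using analyticSet_empty
  have hγm : Measurable γ := by
    refine Measurable.prodMk (continuous_fst.comp hγ).measurable fun s hs => ?_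
    rw [BorelSpace.measurable_eq (α := ℕ → ℕ)]
    exact (continuous_snd.comp hγ).borel_measurable
      (measurableSpace_probabilityMeasure_le_borel Ω₁ s hs)
  -- Parametrizing the graph of `𝔓 t` by the Baire space gives a measurable family over a Polish
  -- space.
  let κ : (ℕ → ℕ) → Measure (Path Ω₁ (t + 1)) := fun z => ((γ z).2 : Measure Ω₁).map (γ z).1.extend
  have hκ : Measurable κ := (measurable_map_extend t).comp hγm
  have hprob : ∀ z, IsProbabilityMeasure (κ z) := fun z =>
    Measure.isProbabilityMeasure_map (γ z).1.measurable_extend.aemeasurable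
  have hint : ∀ z, ∫⁻ ω, g ω ∂κ z =
      ∫⁻ η, g ((γ z).1.extend η) ∂((γ z).2 : Measure Ω₁) := fun z =>
    lintegral_map' ((univMeasurable_of_analyticSet hg).aemeasurable (κ z))
      (γ z).1.measurable_extend.aemeasurable
  convert (analyticSet_lt_lintegral hκ hg a).image_of_continuous hγ using 1
  ext p
  constructor
  · rintro ⟨hp, hlt⟩
    obtain ⟨z, rfl⟩ := hrange.symm.subset hp
    exact ⟨z, by rwa [Set.mem_ofPred_eq, hint], rfl⟩
  · rintro ⟨z, hz, rfl⟩
    rw [Set.mem_ofPred_eq, hint] at hz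
    exact ⟨hrange.subset ⟨z, rfl⟩, hz⟩

theorem lowerSemianalytic_condInf
    (h𝔓 : AnalyticSet {p : Path Ω₁ t × ProbabilityMeasure Ω₁ | p.2 ∈ 𝔓 t p.1})
    (hC : 0 ≤ C) (hFC : ∀ ω x, F ω x ≤ C) {x : Pos d (t + 1)}
    (hF : LowerSemianalytic fun ω => F ω x) :
    LowerSemianalytic fun ω => condInf 𝔓 t F ω x := by
  intro c
  simp_rw [condInf_lt_iff hC hFC hF.univMeasurable]
  rcases lt_or_ge C c with h | h
  · convert h𝔓.image_of_continuous continuous_fst using 1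
    ext ω
    simp [h]
  · convert (analyticSet_lt_lintegral_extend h𝔓 (hF.analyticSet_lt_sub C)
      (ENNReal.ofReal (C - c))).image_of_continuous continuous_fst using 1
    ext ω
    simp [h.not_gt]

/-- A uniform lower bound on the expectations propagates to the conditional expectations, by
measurable selection of almost optimal models. -/
theorem IsAdmissible.ae_bot_lt_condInf
    (h𝔓 : AnalyticSet {p : Path Ω₁ t × ProbabilityMeasure Ω₁ | p.2 ∈ 𝔓 t p.1})
    (hC : 0 ≤ C) (hFC : ∀ ω x, F ω x ≤ C) {x : Pos d (t + 1)}
    (hF : LowerSemianalytic fun ω => F ω x) (ht : t < T)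
    (hinf : ⊥ < ⨅ P ∈ priors 𝔓 T, expect (P : Measure (Path Ω₁ T))
      fun ω => F (ω.restrict (Nat.succ_le_of_lt ht)) x)
    {κ : (t : ℕ) → Path Ω₁ t → ProbabilityMeasure Ω₁} (hκ : IsAdmissible 𝔓 T κ) :
    ∀ᵐ ω ∂pathMeasure κ t, ⊥ < condInf 𝔓 t F ω x := by
  classical
  obtain ⟨r, -, hr⟩ := EReal.lt_iff_exists_real_btwn.1 hinf
  let g : Path Ω₁ (t + 1) → ℝ≥0∞ := fun ω => ((C : EReal) - F ω x).toENNReal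
  have hg : ∀ c, AnalyticSet {ω | c < g ω} := hF.analyticSet_lt_sub C
  let B : Set (Path Ω₁ t) := {ω | condInf 𝔓 t F ω x = ⊥}
  have hB : MeasurableSet[universalCompletion _] B :=
    (lowerSemianalytic_condInf h𝔓 hC hFC hF).univMeasurable (measurableSet_singleton ⊥)
  have := hκ.isProbabilityMeasure ht.le
  have hne : Nonempty (ProbabilityMeasure Ω₁) :=
    let ⟨ω⟩ := nonempty_of_isProbabilityMeasure (pathMeasure κ t)
    ⟨κ t ω⟩
  have hbound : ∀ N : ℕ, (N : ℝ≥0∞) * pathMeasure κ t B ≤ ENNReal.ofReal (C - r) := by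
    intro N
    obtain ⟨h, hh, hsel⟩ := (analyticSet_lt_lintegral_extend h𝔓 hg N).exists_univMeasurable_selector
      (measurableSpace_probabilityMeasure_le_borel Ω₁)
    have hsel' : ∀ ω ∈ B, h ω ∈ 𝔓 t ω ∧
        (N : ℝ≥0∞) < ∫⁻ η, g (ω.extend η) ∂(h ω : Measure Ω₁) := by
      intro ω hω
      refine hsel ω ?_
      -- At level `C - N` the threshold for the integral of `g` is exactly `N`.
      have hlt : condInf 𝔓 t F ω x < ((C - N : ℝ) : EReal) := by
        rw [show condInf 𝔓 t F ω x = ⊥ from hω]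
        exact EReal.bot_lt_coe _
      obtain ⟨P, hP, h1 | h1⟩ := (condInf_lt_iff hC hFC hF.univMeasurable ω _).1 hlt
      · linarith [Nat.cast_nonneg (α := ℝ) N]
      · refine ⟨P, hP, ?_⟩
        rwa [sub_sub_cancel, ENNReal.ofReal_natCast] at h1
    -- Changing only the kernel at time `t`, and only on `B`, keeps the law up to time `t` and
    -- raises the conditional integral of `g` above `N` on `B`.
    let κ' : (t : ℕ) → Path Ω₁ t → ProbabilityMeasure Ω₁ :=
      Function.update κ t (B.piecewise h (κ t))
    have hκ't : κ' t = B.piecewise h (κ t) := Function.update_self _ _ _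
    have hκ' : IsAdmissible 𝔓 T κ' := by
      intro s hs
      rcases eq_or_ne s t with rfl | hst
      · rw [hκ't]
        refine ⟨hh.piecewise (hκ s hs).1 hB, fun ω => ?_⟩
        by_cases hω : ω ∈ B
        · rw [Set.piecewise_eq_of_mem _ _ _ hω]; exact (hsel' ω hω).1
        · rw [Set.piecewise_eq_of_notMem _ _ _ hω]; exact (hκ s hs).2 ω
      · have : κ' s = κ s := Function.update_of_ne hst _ _
        rw [this]
        exact hκ s hs
    have hpath : pathMeasure κ' t = pathMeasure κ t :=
      pathMeasure_congr fun s hs => Function.update_of_ne hs.ne _ _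
    have hpT := hκ'.isProbabilityMeasure le_rfl
    have hpt := hκ'.isProbabilityMeasure (Nat.succ_le_of_lt ht)
    have hgm : AEMeasurable g (pathMeasure κ' (t + 1)) :=
      (univMeasurable_of_analyticSet hg).aemeasurable _
    have hres := measurable_restrict (Ω₁ := Ω₁) (Nat.succ_le_of_lt ht)
    have hmap := hκ'.map_restrict (Nat.succ_le_of_lt ht) le_rfl
    have hFm : AEMeasurable (fun ω : Path Ω₁ T => F (ω.restrict (Nat.succ_le_of_lt ht)) x)
        (pathMeasure κ' T) := by
      refine AEMeasurable.comp_measurable (f := fun ω : Path Ω₁ T => ω.restrict (Nat.succ_le_of_lt ht))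
        (g := fun ω => F ω x) ?_ hres
      rw [hmap]
      exact hF.univMeasurable.aemeasurable _
    have hlow : (r : EReal) < expect (pathMeasure κ' T)
        fun ω => F (ω.restrict (Nat.succ_le_of_lt ht)) x :=
      hr.trans_le (iInf₂_le (⟨pathMeasure κ' T, hpT⟩ : ProbabilityMeasure _)
        (mem_priors_iff.2 ⟨κ', hκ', rfl⟩))
    rw [expect_eq_sub hFm hC fun ω => hFC _ _] at hlow
    calc (N : ℝ≥0∞) * pathMeasure κ t B = ∫⁻ _ in B, N ∂pathMeasure κ' t := by
          rw [setLIntegral_const, hpath]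
      _ ≤ ∫⁻ ω in B, ∫⁻ η, g (ω.extend η) ∂(κ' t ω : Measure Ω₁) ∂pathMeasure κ' t := by
          have hBn : NullMeasurableSet B (pathMeasure κ' t) := hB _ (hpath ▸ this)
          refine lintegral_mono_ae ((ae_restrict_iff'₀ hBn).2 (ae_of_all _ fun ω hω => ?_))
          rw [hκ't, Set.piecewise_eq_of_mem _ _ _ hω]
          exact (hsel' ω hω).2.le
      _ ≤ ∫⁻ ω, ∫⁻ η, g (ω.extend η) ∂(κ' t ω : Measure Ω₁) ∂pathMeasure κ' t :=
          setLIntegral_le_lintegral _ _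
      _ = ∫⁻ ω, g ω ∂pathMeasure κ' (t + 1) := (hκ'.lintegral_succ ht hgm).symm
      _ = ∫⁻ ω, g (ω.restrict (Nat.succ_le_of_lt ht)) ∂pathMeasure κ' T := by
          rw [← hmap] at hgm ⊢
          exact lintegral_map' hgm hres.aemeasurable
      _ ≤ ENNReal.ofReal (C - r) := (lt_sub_coe_ennreal _ _ hlow).le
  have hB0 : pathMeasure κ t B = 0 := by
    by_contra h0
    obtain ⟨N, hN⟩ := ENNReal.exists_nat_mul_gt h0 (ENNReal.ofReal_ne_top (r := C - r))
    exact absurd (hbound N) (not_le.2 hN)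
  filter_upwards [measure_eq_zero_iff_ae_notMem.1 hB0] with ω hω
  exact bot_lt_iff_ne_bot.2 hω

end DynamicProgramming

/-! ### Extending strategies, and inheritance of no-arbitrage -/

section Strategy

variable {Ω₁ : Type*} [MeasurableSpace Ω₁] {d t : ℕ}

/-- Append the position `h` at time `t` to a strategy. -/
def Strategy.snoc (H : Strategy Ω₁ d t) {h : Path Ω₁ t → EuclideanSpace ℝ (Fin d)}
    (hh : UnivMeasurable h) : Strategy Ω₁ d (t + 1) where
  pos := Fin.lastCases (motive := fun s : Fin (t + 1) => Path Ω₁ s → EuclideanSpace ℝ (Fin d))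
    h fun s => H.pos s
  adapted s := by
    induction s using Fin.lastCases with
    | last => rw [Fin.lastCases_last]; exact hh
    | cast s => rw [Fin.lastCases_castSucc]; exact H.adapted s

/-- The strategy which never trades. -/
def Strategy.zero (Ω₁ : Type*) [MeasurableSpace Ω₁] (d t : ℕ) : Strategy Ω₁ d t where
  pos _ _ := 0
  adapted _ := .of_measurable measurable_const

theorem Strategy.eval_snoc (H : Strategy Ω₁ d t) {h : Path Ω₁ t → EuclideanSpace ℝ (Fin d)}
    (hh : UnivMeasurable h) (ω : Path Ω₁ (t + 1)) :
    (H.snoc hh).eval ω =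
      (H.eval (ω.restrict (Nat.le_succ t))).extend (h (ω.restrict (Nat.le_succ t))) := by
  funext i
  induction i using Fin.lastCases with
  | last =>
    simp only [Strategy.eval, Strategy.snoc, Pos.extend, Fin.snoc_last, Fin.lastCases_last]
  | cast i =>
    simp only [Strategy.eval, Strategy.snoc, Pos.extend, Fin.snoc_castSucc, Fin.lastCases_castSucc]
    rfl

theorem Strategy.eval_zero (ω : Path Ω₁ t) : (Strategy.zero Ω₁ d t).eval ω = 0 := rfl

theorem Strategy.univMeasurable_eval [TopologicalSpace Ω₁] [PolishSpace Ω₁] [BorelSpace Ω₁]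
    (H : Strategy Ω₁ d t) : UnivMeasurable H.eval :=
  UnivMeasurable.pi fun s => (H.adapted s).comp (.of_measurable (measurable_restrict s.isLt.le))

end Strategy

/-- No-arbitrage is inherited by one step of the backward recursion. -/
theorem noArbitrage_dpStep {Ω₁ : Type*} [TopologicalSpace Ω₁] [PolishSpace Ω₁] [MeasurableSpace Ω₁]
    [BorelSpace Ω₁] {d T t : ℕ} {𝔓 : (t : ℕ) → Path Ω₁ t → Set (ProbabilityMeasure Ω₁)}
    (ht : t < T) (hne : ∀ ω, (𝔓 t ω).Nonempty)
    (h𝔓 : AnalyticSet {p : Path Ω₁ t × ProbabilityMeasure Ω₁ | p.2 ∈ 𝔓 t p.1})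
    {F : Integrand Ω₁ d (t + 1)} (hF : StandingAssumption 𝔓 T (Nat.succ_le_of_lt ht) F)
    (hNA : NoArbitrage 𝔓 T (Nat.succ_le_of_lt ht) F) :
    NoArbitrage 𝔓 T ht.le (dpStep 𝔓 t F) := by
  classical
  obtain ⟨D, hD, hFD⟩ := hF.grid
  obtain ⟨C, hC, hFC⟩ : ∃ C : ℝ, 0 ≤ C ∧ ∀ ω x, F ω x ≤ C := by
    obtain ⟨C, hC⟩ := hF.bounded
    exact ⟨max C 0, le_max_right _ _, fun ω x =>
      (hC ω x).trans (EReal.coe_le_coe_iff.2 (le_max_left _ _))⟩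
  have hlsa : ∀ z, LowerSemianalytic fun ω => F ω z := fun z c =>
    (hF.lsa c).preimage (Continuous.prodMk_left z)
  have hFm : ∀ z, UnivMeasurable fun ω => F ω z := fun z => (hlsa z).univMeasurable
  have hΦm : ∀ z, UnivMeasurable fun ω => condInf 𝔓 t F ω z := fun z =>
    (lowerSemianalytic_condInf h𝔓 hC hFC (hlsa z)).univMeasurable
  have hΦD : ∀ ω, ∀ z ∉ D, condInf 𝔓 t F ω z = ⊥ := fun ω z hz =>
    condInf_eq_bot (hne ω) fun ω' => hFD ω' z hz
  have hNA' : ∀ H : Strategy Ω₁ d (t + 1),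
      (∀ κ, IsAdmissible 𝔓 T κ → ∀ᵐ ω ∂pathMeasure κ (t + 1), 0 ≤ horizon (F ω) (H.eval ω)) ↔
      ∀ κ, IsAdmissible 𝔓 T κ → ∀ᵐ ω ∂pathMeasure κ (t + 1), H.eval ω = 0 := fun H => by
    rw [← quasiSurely_restrict_iff (Nat.succ_le_of_lt ht),
      ← quasiSurely_restrict_iff (Nat.succ_le_of_lt ht)]
    exact hNA H
  -- The reverse implication in no-arbitrage, needed wherever an extended position is switched off.
  have hzero : ∀ κ, IsAdmissible 𝔓 T κ →
      ∀ᵐ ω ∂pathMeasure κ (t + 1), 0 ≤ horizon (F ω) 0 :=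
    (hNA' (Strategy.zero Ω₁ d (t + 1))).2 fun κ _ => Eventually.of_forall Strategy.eval_zero
  -- Transfer to time `t + 1`. The alternative of a zero position lets a selector act on a
  -- measurable set only.
  have hlift : ∀ (H : Strategy Ω₁ d t) (h : Path Ω₁ t → EuclideanSpace ℝ (Fin d))
      (hh : UnivMeasurable h),
      (∀ κ, IsAdmissible 𝔓 T κ → ∀ᵐ ω ∂pathMeasure κ t,
        0 ≤ horizon (condInf 𝔓 t F ω) ((H.eval ω).extend (h ω)) ∨
          (H.eval ω).extend (h ω) = 0) →
      ∀ κ, IsAdmissible 𝔓 T κ → ∀ᵐ ω ∂pathMeasure κ t, H.eval ω = 0 ∧ h ω = 0 := by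
    intro H h hh hnonneg κ hκ
    have hall : ∀ κ, IsAdmissible 𝔓 T κ → ∀ᵐ ω ∂pathMeasure κ (t + 1),
        0 ≤ horizon (F ω) ((H.snoc hh).eval ω) := by
      intro κ hκ
      refine hκ.ae_of_ae_ae ht (measurableSet_zero_le_horizon hD.countable hFm hFD
        (H.snoc hh).univMeasurable_eval) ?_
      filter_upwards [hnonneg κ hκ, hκ.ae_succ ht (hzero κ hκ)] with ω h1 h2
      simp only [Strategy.eval_snoc, Path.restrict_extend]
      rcases h1 with h1 | h1
      · exact ae_zero_le_horizon (fun z => (hFm z).aemeasurable_comp_extend ω _) hC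
          (fun η z => hFC _ z) (fun z => condInf_le_expect ((hκ t ht).2 ω) z) h1
      · rw [h1]
        exact h2
    filter_upwards [hκ.ae_succ ht ((hNA' _).1 hall κ hκ)] with ω hω
    obtain ⟨η, hη⟩ := hω.exists
    rwa [Strategy.eval_snoc, Path.restrict_extend, Pos.extend_eq_zero_iff] at hη
  intro H
  rw [quasiSurely_restrict_iff ht.le (p := fun ω => 0 ≤ horizon (dpStep 𝔓 t F ω) (H.eval ω)),
    quasiSurely_restrict_iff ht.le (p := fun ω => H.eval ω = 0)]
  constructor
  · intro hH
    obtain ⟨-, s, hs, hsel⟩ := exists_univMeasurable_zero_le_horizon hD.countable hΦm hΦD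
      H.univMeasurable_eval MeasurableSet.univ
    obtain ⟨hN, s₀, hs₀, hsel₀⟩ := exists_univMeasurable_zero_le_horizon hD.countable hΦm hΦD
      (H := fun _ => (0 : Pos d t)) (.of_measurable measurable_const)
      (Metric.isClosed_sphere (x := (0 : EuclideanSpace ℝ (Fin d))) (ε := 1)).measurableSet
    set N := {ω | ∃ h ∈ Metric.sphere (0 : EuclideanSpace ℝ (Fin d)) 1,
      0 ≤ horizon (condInf 𝔓 t F ω) (Pos.extend 0 h)}
    have hpolar : ∀ κ, IsAdmissible 𝔓 T κ → ∀ᵐ ω ∂pathMeasure κ t, ω ∉ N := by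
      intro κ hκ
      -- Trading only at time `t` and only on `N`: the position must vanish quasi surely, yet it has
      -- norm one on `N`.
      have hs₀' : UnivMeasurable (N.piecewise s₀ 0) :=
        hs₀.piecewise (.of_measurable measurable_const) hN
      have hvanish := hlift (Strategy.zero Ω₁ d t) _ hs₀' (fun κ _ => Eventually.of_forall
        fun ω => by
          rw [Strategy.eval_zero]
          by_cases hω : ω ∈ N
          · rw [Set.piecewise_eq_of_mem _ _ _ hω]
            exact Or.inl (hsel₀ ω hω).2
          · rw [Set.piecewise_eq_of_notMem _ _ _ hω]
            exact Or.inr ((Pos.extend_eq_zero_iff _ _).2 ⟨rfl, rfl⟩)) κ hκ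
      filter_upwards [hvanish] with ω hω hωN
      have hnorm := (hsel₀ ω hωN).1
      rw [Set.piecewise_eq_of_mem _ _ _ hωN] at hω
      simp [hω.2] at hnorm
    intro κ hκ
    refine (hlift H s hs (fun κ hκ => ?_) κ hκ).mono fun ω hω => hω.1
    filter_upwards [hH κ hκ, hpolar κ hκ] with ω h1 h2
    rcases exists_zero_le_horizon_of_iSup (φ := condInf 𝔓 t F ω) h1 with ⟨h, hh⟩ | ⟨h, hh1, hh⟩
    · exact Or.inl (hsel ω ⟨h, Set.mem_univ _, hh⟩).2
    · exact absurd ⟨h, mem_sphere_zero_iff_norm.2 hh1, hh⟩ h2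
  -- At zero it is enough that `dpStep` exceeds `⊥`, and the choice of last position `0` already
  -- shows this.
  · intro hH κ hκ
    filter_upwards [hH κ hκ, hκ.ae_bot_lt_condInf h𝔓 hC hFC (hlsa 0) ht hF.zero] with ω h1 h2
    rw [h1]
    refine zero_le_horizon_zero (h2.trans_le ?_)
    have h0 : Pos.extend (0 : Pos d t) 0 = 0 := (Pos.extend_eq_zero_iff _ _).2 ⟨rfl, rfl⟩
    rw [← h0]
    exact le_iSup (fun y => condInf 𝔓 t F ω (Pos.extend 0 y)) 0

end RobustDP

theorem proposition5p5 {Ω₁ : Type*} [TopologicalSpace Ω₁] [PolishSpace Ω₁] [MeasurableSpace Ω₁]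
    [BorelSpace Ω₁] (d T : ℕ)
    (𝔓 : (t : ℕ) → RobustDP.Path Ω₁ t → Set (ProbabilityMeasure Ω₁))
    (h𝔓_nonempty : ∀ t < T, ∀ ω, (𝔓 t ω).Nonempty)
    (h𝔓_analytic : ∀ t < T, AnalyticSet
      {p : RobustDP.Path Ω₁ t × ProbabilityMeasure Ω₁ | p.2 ∈ 𝔓 t p.1})
    (Ψ : RobustDP.Integrand Ω₁ d T) (t : ℕ) (ht : t < T)
    (hΨ : RobustDP.StandingAssumption 𝔓 T (Nat.succ_le_of_lt ht)
      (RobustDP.dynProg 𝔓 Ψ (Nat.succ_le_of_lt ht)))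
    (hNA : RobustDP.NoArbitrage 𝔓 T (Nat.succ_le_of_lt ht)
      (RobustDP.dynProg 𝔓 Ψ (Nat.succ_le_of_lt ht))) :
    RobustDP.NoArbitrage 𝔓 T ht.le (RobustDP.dynProg 𝔓 Ψ ht.le) := by
  rw [RobustDP.dynProg_succ 𝔓 Ψ ht]
  exact RobustDP.noArbitrage_dpStep ht (h𝔓_nonempty t ht) (h𝔓_analytic t ht) hΨ hNA
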